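/- \textbf{Setting.} Let $m,q,L\ge 1$ be integers, $n=N=mq$, $M=m$, $\beta>0$, $h\in\mathbb R$, and let $V:[0,\infty)\to\mathbb R$ vanish on $[1,\infty)$. The sites of the discrete circle $\mathbb Z/N$ are divided into $m$ consecutive cells $C_k$ ($0\le k<m$) of $q$ sites each. Write $|\cdot|$ for the graph distance on a discrete circle, $J(x-y)=\frac1L V\big(\frac{|x-y|}{L}\big)$, and for $\sigma\in\{\pm1\}^{N}$ $$H_N(\sigma)=-\tfrac12\sum_x\sum_{y\ne x}J(x-y)\sigma(x)\sigma(y)+h\sum_x\sigma(x).$$ Let $P_N$ be the uniform (product Bernoulli-$\frac12$) measure on $\{\pm1\}^N$, $\mu_{N,\beta}\propto e^{-\beta H_N}P_N$, $\mathbf F(\sigma)=\big(\sum_{x\in C_k}\sigma(x)\big)_k$ with values $\eta\in\{-q,-q+2,\dots,q\}^m$, $\bar P_M=P_N\circ\mathbf F^{-1}$, and $\mathbb E[\,\cdot\,|\eta]$ the expectation under $P_N$ conditioned on $\mathbf F(\sigma)=\eta$. Put $$e^{-\beta\bar H_M(\eta)}=\mathbb E[e^{-\beta H_N}|\eta],\qquad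 \bar H^{(0)}_M(\eta)=\mathbb E[H_N|\eta].$$ Let $\bar J(k,l)=q^{-2}\sum_{x\in C_k,y\in C_l}J(x-y)$ for $k\ne l$, $\bar J(k,k)=\frac1{q(q-1)}\sum_{x\ne y\in C_k}J(x-y)$ (read as $0$ if $q=1$), and $$\Delta_{kl}J(\sigma)=-\tfrac12\sum_{x\in C_k,\,y\in C_l,\,y\ne x}(J(x-y)-\bar J(k,l))\sigma(x)\sigma(y)(2-\delta_{kl}),\qquad f_{kl}=e^{-\beta\Delta_{kl}J}-1 .$$ For a non-empty set $R$ of cells (a cluster) the activity is $\zeta(R)=\zeta_\eta(R)=\mathbb E\big[\sum_{g}\prod_{\{k,l\}\in g}f_{kl}\,\big|\,\eta\big]$, the sum running over all edge sets $g$ (loops allowed) whose graph is connected and whose set of endpoints is exactly $R$. The \emph{small-activity condition} with parameter $\delta$ is: for every $\eta$ and every cell $k$, $$\sum_{R\ni k,\ |R|=1}|\zeta(R)|\le\delta\qquad\text{and}\qquad \sum_{R\ni k,\ |R|=r}|\zeta(R)|\le\delta^{r-1}\quad(r\ge2).$$ Write $k\approx l$ if the cells $k,l$ have distance at most $\lceil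 L/q\rceil$ on the circle of $m$ cells, $z_k=\mathbb E[f_{kk}|\eta]$, $$z_{kl}=\mathbb E[f_{kl}+f_{kl}f_{kk}+f_{kl}f_{ll}+f_{kl}f_{kk}f_{ll}|\eta],$$ $$z_{klp}=\mathbb E\big[(f_{kl}f_{lp}+f_{kl}f_{kp}+f_{kp}f_{lp}+f_{kl}f_{lp}f_{kp})(1+f_{kk})(1+f_{ll})(1+f_{pp})\big|\eta\big],$$ and define the corrections $$\bar H^{(1)}_M=-\frac1\beta\Big(\sum_k z_k+\sum_k\sum_{l>k,\,l\approx k}z_{kl}\Big),$$ $$\bar H^{(2)}_M=\frac1\beta\Big(\tfrac12\sum_k z_k^2+\sum_k\sum_{l\ne k,\,l\approx k}z_kz_{kl}+\tfrac12\sum_k\sum_{l>k,\,l\approx k}z_{kl}^2+\tfrac12\sum_k\sum_{\substack{l\ne p;\ l,p\ne k\\ l\approx k,\,p\approx k}}z_{kl}z_{kp}-\sum_{k<l<p}{}^{'}z_{klp}\Big),$$ where $\sum'$ is restricted to triples in which at least two of the three pairs are $\approx$-related. For $p=0,1,2$ let $\bar\mu^{(p)}_{M,\beta}\propto e^{-\beta(\bar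 H^{(0)}_M+\dots+\bar H^{(p)}_M)}\bar P_M$. \textbf{Proposition (Corrections to $\bar H_M^{(0)}$).} (a) In general, with $\phi(R_1,R_2)=-1$ if $R_1\cap R_2\ne\emptyset$ and $0$ otherwise, $$\bar H^{(1)}_M=-\frac1\beta\sum_{|R|\in\{1,2\}}\zeta(R),\qquad \bar H^{(2)}_M=-\frac1\beta\Big(\tfrac12\sum_{|R_1|,|R_2|\in\{1,2\}}\phi(R_1,R_2)\zeta(R_1)\zeta(R_2)+\sum_{|R|=3}\zeta(R)\Big).$$ (b) There is a universal constant $C$ such that, for all data $m,q,L,V,h,\beta$ as above for which the small-activity condition holds with some $\delta<\frac16$, and for all $\eta$, $$\beta\,|\bar H_M-\bar H^{(0)}_M|\le C M\delta,\quad \beta\,|\bar H_M-\bar H^{(0)}_M-\bar H^{(1)}_M|\le C M\delta^2,\quad \beta\,|\bar H_M-\bar H^{(0)}_M-\bar H^{(1)}_M-\bar H^{(2)}_M|\le C M\delta^3,$$ and, for $p=0,1,2$, the relative entropy per site satisfies $$\frac1N\,\mathcal R\big(\bar\mu^{(p)}_{M,\beta}\,\big|\,\mu_{N,\beta}\circ\mathbf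 F^{-1}\big)\le \frac{C}{q}\,\delta^{p+1}.$$ -/

import Mathlib

open MeasureTheory ProbabilityTheory InformationTheory

namespace CoarseGraining

/-- Graph distance of two points `a, b < n` of the discrete circle `ℤ / n`; for sites `x, y` of the
lattice `(1/n) ℤ` on the unit torus it is `n |x - y|`. -/
def circDist (n a b : ℕ) : ℕ := min (Nat.dist a b) (n - Nat.dist a b)

/-- The values `-q, -q + 2, …, q` of a block spin of a cell with `q` sites. -/
def coarseSpins (q : ℕ) : Finset ℤ := (Finset.range (q + 1)).image fun a : ℕ => 2 * (a : ℤ) - q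

/-- A one-dimensional periodic Ising system: `m` cells with `q` sites each, pair potential
`J(x - y) = L⁻¹ V (n |x - y| / L)` with `n = m q` and `V = 0` on `[1, ∞)`, a constant external
field `h`, and the inverse temperature `β`. -/
structure IsingModel where
  m : ℕ
  q : ℕ
  L : ℕ
  m_pos : 0 < m
  q_pos : 0 < q
  L_pos : 0 < L
  V : ℝ → ℝ
  V_eq_zero : ∀ r, 1 ≤ r → V r = 0
  h : ℝ
  β : ℝ
  β_pos : 0 < β

namespace IsingModel

noncomputable section

variable (S : IsingModel)

/-- The coarse cells. -/
abbrev Cell := Fin S.m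

/-- The microscopic sites: `(k, i)` is the `i`-th site of the cell `C_k`. -/
abbrev Site := S.Cell × Fin S.q

/-- Spin configurations; `ℤˣ = {1, -1}`. -/
abbrev SpinConfig := S.Site → ℤˣ

/-- Configurations of block spins. -/
abbrev CoarseConfig := S.Cell → coarseSpins S.q

/-- The position `k q + i` of a site on the discrete circle of length `n = m q`. -/
def pos (x : S.Site) : ℕ := x.1 * S.q + x.2

/-- The pair potential `J(x - y)`. -/
def J (x y : S.Site) : ℝ :=
  (S.L : ℝ)⁻¹ * S.V ((circDist (S.m * S.q) (S.pos x) (S.pos y) : ℝ) / S.L)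

/-- The real value of the spin at `x`. -/
def spin (σ : S.SpinConfig) (x : S.Site) : ℝ := ((σ x : ℤ) : ℝ)

/-- The microscopic Hamiltonian `H_N`. -/
def energy (σ : S.SpinConfig) : ℝ :=
  -(1 / 2) * ∑ x, ∑ y ∈ Finset.univ.filter (fun y => y ≠ x), S.J x y * S.spin σ x * S.spin σ y
    + S.h * ∑ x, S.spin σ x

/-- The prior distribution `P_N`: independent symmetric spins. -/
def prior : Measure S.SpinConfig := Measure.pi fun _ => uniformOn (Set.univ : Set ℤˣ)

/-- The microscopic Gibbs measure `Z⁻¹ exp (-β H_N) dP_N`. -/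
def microGibbs : Measure S.SpinConfig := S.prior.tilted fun σ => -S.β * S.energy σ

theorem sum_mem_coarseSpins (q : ℕ) (s : Fin q → ℤˣ) :
    ∑ i, (s i : ℤ) ∈ coarseSpins q := by
  refine Finset.mem_image.2 ⟨(Finset.univ.filter fun i => s i = 1).card, ?_, ?_⟩
  · rw [Finset.mem_range, Nat.lt_succ_iff]
    simpa using Finset.card_filter_le (Finset.univ : Finset (Fin q)) (fun i => s i = 1)
  · have h : ∀ i, (s i : ℤ) = 2 * (if s i = 1 then 1 else 0) - 1 := by
      intro i
      rcases Int.units_eq_one_or (s i) with h | h <;> simp [h]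
    rw [Finset.sum_congr rfl fun i _ => h i]
    rw [Finset.sum_sub_distrib, ← Finset.mul_sum, Finset.sum_boole]
    simp

/-- The coarse-graining map `F`, `F σ k = ∑_{x ∈ C_k} σ x`. -/
def block (σ : S.SpinConfig) : S.CoarseConfig := fun k =>
  ⟨∑ i, (σ (k, i) : ℤ), sum_mem_coarseSpins S.q fun i => σ (k, i)⟩

/-- The coarse prior `P_N ∘ F⁻¹`. -/
def coarsePrior : Measure S.CoarseConfig := S.prior.map S.block

/-- The conditional measure `P_N (dσ | η) = ∏_k ρ̃_{k, η(k)} (dσ)`. -/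
def condPrior (η : S.CoarseConfig) : Measure S.SpinConfig := cond S.prior (S.block ⁻¹' {η})

/-- The conditional expectation `E[f | η]`. If `f` depends only on the spins in the cells of a set
`R`, it is the integral of `f` against `∏_{k ∈ R} ρ̃_{k, η(k)}`. -/
def condExpect (η : S.CoarseConfig) (f : S.SpinConfig → ℝ) : ℝ := ∫ σ, f σ ∂S.condPrior η

/-- The exact coarse-grained Hamiltonian: `exp (-β H̄_M(η)) = E[exp (-β H_N) | η]`. -/
def exactH (η : S.CoarseConfig) : ℝ :=
  -(1 / S.β) * Real.log (S.condExpect η fun σ => Real.exp (-S.β * S.energy σ))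

/-- The first approximation `H̄⁽⁰⁾_M(η) = E[H_N | η]`. -/
def H0 (η : S.CoarseConfig) : ℝ := S.condExpect η S.energy

/-- The potential averaged over a pair of cells. -/
def Jbar (k l : S.Cell) : ℝ :=
  if k = l then
    (1 / ((S.q : ℝ) * (S.q - 1))) *
      ∑ i : Fin S.q, ∑ j ∈ Finset.univ.filter (fun j => j ≠ i), S.J (k, i) (k, j)
  else (1 / (S.q : ℝ) ^ 2) * ∑ i : Fin S.q, ∑ j : Fin S.q, S.J (k, i) (l, j)

/-- `Δ_{kl} J(σ)`. -/
def Delta (k l : S.Cell) (σ : S.SpinConfig) : ℝ :=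
  -(1 / 2) * ∑ i : Fin S.q, ∑ j ∈ Finset.univ.filter (fun j : Fin S.q => (l, j) ≠ (k, i)),
    (S.J (k, i) (l, j) - S.Jbar k l) * S.spin σ (k, i) * S.spin σ (l, j) *
      (2 - if k = l then 1 else 0)

/-- `f_{kl}(σ) = exp (-β Δ_{kl} J(σ)) - 1`. -/
def f (k l : S.Cell) (σ : S.SpinConfig) : ℝ := Real.exp (-S.β * S.Delta k l σ) - 1

/-- The graph with edge set `g` (loops allowed) is connected and its support, the set of the
endpoints of its edges, is `R`. -/
def IsConnectedOn (g : Finset (Sym2 S.Cell)) (R : Finset S.Cell) : Prop :=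
  (∀ k, k ∈ R ↔ ∃ e ∈ g, k ∈ e) ∧
    ((SimpleGraph.fromEdgeSet (g : Set (Sym2 S.Cell))).induce (R : Set S.Cell)).Connected

open scoped Classical in
/-- The activity `ζ(R)` of a cluster `R` of cells, for the block spins `η`. -/
def activity (η : S.CoarseConfig) (R : Finset S.Cell) : ℝ :=
  S.condExpect η fun σ =>
    ∑ g ∈ Finset.univ.filter (fun g => S.IsConnectedOn g R), ∏ e ∈ g, S.f e.inf e.sup σ

/-- The small-activity condition for the block spins `η`. -/
def SmallActivity (δ : ℝ) (η : S.CoarseConfig) : Prop :=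
  (∀ k : S.Cell, ∑ R : Finset S.Cell with k ∈ R ∧ R.card = 1, |S.activity η R| ≤ δ) ∧
  ∀ r : ℕ, 2 ≤ r → ∀ k : S.Cell,
    ∑ R : Finset S.Cell with k ∈ R ∧ R.card = r, |S.activity η R| ≤ δ ^ (r - 1)

/-- `l` lies in the ball of radius `⌈L / q⌉` about `k`, on the circle of the `m` cells. -/
def Near (k l : S.Cell) : Prop := circDist S.m k l ≤ ⌈(S.L : ℚ) / S.q⌉₊

/-- The one-cell integral. -/
def z1 (η : S.CoarseConfig) (k : S.Cell) : ℝ := S.condExpect η (S.f k k)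

/-- The two-cell integral. -/
def z2 (η : S.CoarseConfig) (k l : S.Cell) : ℝ :=
  S.condExpect η fun σ =>
    S.f k l σ + S.f k l σ * S.f k k σ + S.f k l σ * S.f l l σ + S.f k l σ * S.f k k σ * S.f l l σ

/-- The three-cell integral: the connected graphs on three cells, with all combinations of
loops. -/
def z3 (η : S.CoarseConfig) (k l p : S.Cell) : ℝ :=
  S.condExpect η fun σ =>
    (S.f k l σ * S.f l p σ + S.f k l σ * S.f k p σ + S.f k p σ * S.f l p σ
        + S.f k l σ * S.f l p σ * S.f k p σ) *
      ((1 + S.f k k σ) * (1 + S.f l l σ) * (1 + S.f p p σ))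

open scoped Classical in
/-- The first correction `H̄⁽¹⁾_M`. -/
def H1 (η : S.CoarseConfig) : ℝ :=
  -(1 / S.β) * (∑ k, S.z1 η k + ∑ k, ∑ l : S.Cell with k < l ∧ S.Near k l, S.z2 η k l)

open scoped Classical in
/-- The second correction `H̄⁽²⁾_M`. -/
def H2 (η : S.CoarseConfig) : ℝ :=
  (1 / S.β) *
    (1 / 2 * ∑ k, S.z1 η k ^ 2
      + ∑ k, ∑ l : S.Cell with l ≠ k ∧ S.Near k l, S.z1 η k * S.z2 η k l
      + 1 / 2 * ∑ k, ∑ l : S.Cell with k < l ∧ S.Near k l, S.z2 η k l ^ 2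
      + 1 / 2 * ∑ k, ∑ l : S.Cell with l ≠ k ∧ S.Near k l,
          ∑ p : S.Cell with p ≠ k ∧ p ≠ l ∧ S.Near k p, S.z2 η k l * S.z2 η k p
      - ∑ k, ∑ l : S.Cell with k < l, ∑ p : S.Cell with l < p ∧
          ((S.Near k l ∧ S.Near l p) ∨ (S.Near k l ∧ S.Near k p) ∨ (S.Near k p ∧ S.Near l p)),
          S.z3 η k l p)

/-- The two-cluster coefficient: `-1` if the clusters meet and `0` otherwise. -/
def phi (R₁ R₂ : Finset S.Cell) : ℝ := if Disjoint R₁ R₂ then 0 else -1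

/-- The effective Hamiltonian `H̄⁽⁰⁾_M + … + H̄⁽ᵖ⁾_M`, for `p = 0, 1, 2`. -/
def effectiveH (p : Fin 3) (η : S.CoarseConfig) : ℝ :=
  ![S.H0 η, S.H0 η + S.H1 η, S.H0 η + S.H1 η + S.H2 η] p

/-- The coarse Gibbs measure `μ̄⁽ᵖ⁾_{M,β}` of the `p`-th effective Hamiltonian. -/
def effectiveGibbs (p : Fin 3) : Measure S.CoarseConfig :=
  S.coarsePrior.tilted fun η => -S.β * S.effectiveH p η

end

end IsingModel

end CoarseGraining

/-! Given `η`, the energy equals `H0 η` plus the fluctuations `Delta k l` summed over unordered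
pairs of cells, because the averaged part of the interaction depends on `η` alone
(`energy_eq_H0_add`). Hence `exactH - H0` is, up to the factor `-1/β`, the logarithm of `clusterZ`,
the conditional mean of the product of all `1 + f k l` (`log_clusterZ`). Expanding this product over
edge sets and isolating the connected component of one cell `k` gives the recursion `Z Λ = Z (Λ \ k)
+ ∑ w R * Z (Λ \ R)` over polymers `R ∋ k`. The conditional measure is a product over cells, so the
weights `w` are exactly the activities (`prod_one_add_sym2`, `condExpect_mul`, `isPolymerGas`).

The analysis uses only this recursion. If `δ ≤ 1/10`, an induction on `Λ` shows that `Z` is positive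
and that removing a point changes it by a factor within `5δ` of one (`pos_and_ratio`). Reinserting
these ratio bounds into the recursion gives the increment of `log Z` at one point up to `O(δ²)`,
then up to `O(δ³)`. The main terms are the increments of `firstOrder` and `secondOrder`, so
telescoping over the points costs one factor `M`. No convergence theorem for cluster expansions is
needed.

For `1/10 ≤ δ < 1/6` the powers of `δ` are comparable and crude bounds suffice. The recursion gives
`Z ≤ (1 + 3δ)^M`; Jensen's inequality gives `Z ≥ 1`, since by exchangeability within cells the
fluctuations have conditional mean zero (`condExpect_Delta`, `one_le_clusterZ`).

Part (a) evaluates the activities of one, two and three cells and sorts intersecting pairs of small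
clusters by their common cells (`secondOrder_univ`). The entropy bound holds because each effective
Gibbs measure is a tilt of the exact coarse measure by a uniformly small function
(`klDiv_tilted_le`). -/

namespace CoarseGraining

/-! ### Polymer recursion: positivity and ratio bounds. -/

section PolymerGas

variable {K : Type*} [DecidableEq K]

/-- The recursion, obtained by removing one point, of the partition functions of a gas of disjoint
polymers with weights `w`. -/
structure IsPolymerGas (w Z : Finset K → ℝ) : Prop where
  empty : Z ∅ = 1
  step : ∀ Λ : Finset K, ∀ k ∈ Λ,
    Z Λ = Z (Λ.erase k) + ∑ R ∈ Λ.powerset with k ∈ R, w R * Z (Λ \ R)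

/-- The weights of the polymers of size `r` through a given point are at most `δ ^ (r - 1)`
(at most `δ` if `r = 1`). -/
structure SmallWeights [Fintype K] (w : Finset K → ℝ) (δ : ℝ) : Prop where
  one : ∀ k : K, ∑ R : Finset K with k ∈ R ∧ R.card = 1, |w R| ≤ δ
  two_le : ∀ r : ℕ, 2 ≤ r → ∀ k : K, ∑ R : Finset K with k ∈ R ∧ R.card = r, |w R| ≤ δ ^ (r - 1)

theorem geom_sum_le_two {y : ℝ} (hy : 0 ≤ y) (hy' : y ≤ 1 / 2) (n : ℕ) :
    ∑ i ∈ Finset.range n, y ^ i ≤ 2 :=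
  (Finset.sum_le_sum fun i _ => pow_le_pow_left₀ hy hy' i).trans (sum_geometric_two_le n)

theorem abs_le_card_mul {f : Finset K → ℝ} {c : ℝ} (h0 : f ∅ = 0)
    (h : ∀ Λ : Finset K, ∀ k ∈ Λ, |f Λ - f (Λ.erase k)| ≤ c) (Λ : Finset K) :
    |f Λ| ≤ Λ.card * c := by
  induction Λ using Finset.induction_on with
  | empty => simp [h0]
  | insert k Λ hk ih =>
    have h1 := h (insert k Λ) k (Finset.mem_insert_self _ _)
    rw [Finset.erase_insert hk] at h1
    rw [Finset.card_insert_of_notMem hk]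
    push_cast
    have h2 := abs_add_le (f (insert k Λ) - f Λ) (f Λ)
    rw [sub_add_cancel] at h2
    linarith

namespace SmallWeights

variable [Fintype K] {w : Finset K → ℝ} {δ : ℝ}

theorem nonneg (hw : SmallWeights w δ) (k : K) : 0 ≤ δ :=
  (Finset.sum_nonneg fun _ _ => abs_nonneg _).trans (hw.one k)

/-- Polymers of size `r` contribute at most `(δx)^(r-1)`, a geometric series of ratio at most `1/2`.
The factor `x^(|R|-1)` leaves room for the growth of `Z (Λ \ R) / Z (Λ.erase k)` in the size of `R`.
-/
theorem sum_tail_le (hw : SmallWeights w δ) (hδ : 0 ≤ δ) {x : ℝ} (hx : 0 ≤ x)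
    (hδx : δ * x ≤ 1 / 2) {s : ℕ} (hs : 2 ≤ s) (k : K) :
    ∑ R : Finset K with k ∈ R ∧ s ≤ R.card, |w R| * x ^ (R.card - 1) ≤ 2 * (δ * x) ^ (s - 1) := by
  have hmaps : ∀ R ∈ (Finset.univ.filter fun R : Finset K => k ∈ R ∧ s ≤ R.card),
      R.card ∈ Finset.Ico s (Fintype.card K + 1) := by
    intro R hR
    have := Finset.card_le_univ R
    simp only [Finset.mem_filter, Finset.mem_univ, true_and] at hR
    simp only [Finset.mem_Ico]
    omega
  rw [← Finset.sum_fiberwise_of_maps_to hmaps]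
  calc _ ≤ ∑ r ∈ Finset.Ico s (Fintype.card K + 1), (δ * x) ^ (r - 1) := by
        refine Finset.sum_le_sum fun r hr => ?_
        rw [Finset.mem_Ico] at hr
        rw [Finset.filter_filter]
        have h1 : ∀ R ∈ (Finset.univ.filter fun R : Finset K => (k ∈ R ∧ s ≤ R.card) ∧ R.card = r),
            |w R| * x ^ (R.card - 1) = |w R| * x ^ (r - 1) := by
          intro R hR
          rw [(Finset.mem_filter.1 hR).2.2]
        rw [Finset.sum_congr rfl h1, ← Finset.sum_mul, mul_pow]
        refine mul_le_mul_of_nonneg_right ?_ (pow_nonneg hx _)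
        refine le_trans ?_ (hw.two_le r (hs.trans hr.1) k)
        refine Finset.sum_le_sum_of_subset_of_nonneg ?_ fun _ _ _ => abs_nonneg _
        intro R
        simp only [Finset.mem_filter, Finset.mem_univ, true_and]
        tauto
    _ = (δ * x) ^ (s - 1) * ∑ i ∈ Finset.range (Fintype.card K + 1 - s), (δ * x) ^ i := by
        rw [Finset.sum_Ico_eq_sum_range, Finset.mul_sum]
        refine Finset.sum_congr rfl fun i _ => ?_
        rw [← pow_add]
        congr 1
        omega
    _ ≤ _ := by
        have := geom_sum_le_two (mul_nonneg hδ hx) hδx (Fintype.card K + 1 - s)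
        rw [mul_comm]
        exact mul_le_mul_of_nonneg_right this (pow_nonneg (mul_nonneg hδ hx) _)

theorem sum_abs_le (hw : SmallWeights w δ) (hδ : 0 ≤ δ) (hδ' : δ ≤ 1 / 2) (k : K)
    (Λ : Finset K) : ∑ R ∈ Λ.powerset with k ∈ R, |w R| ≤ 3 * δ := by
  have h := hw.sum_tail_le hδ zero_le_one (by simpa using hδ') le_rfl k
  have h1 := hw.one k
  simp only [one_pow, mul_one, Nat.add_one_sub_one, pow_one] at h
  calc ∑ R ∈ Λ.powerset with k ∈ R, |w R|
      ≤ ∑ R ∈ ((Finset.univ.filter fun R : Finset K => k ∈ R ∧ R.card = 1) ∪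
          Finset.univ.filter fun R : Finset K => k ∈ R ∧ 2 ≤ R.card), |w R| := by
        refine Finset.sum_le_sum_of_subset_of_nonneg ?_ fun _ _ _ => abs_nonneg _
        intro R hR
        have hk := (Finset.mem_filter.1 hR).2
        have := Finset.card_pos.2 ⟨k, hk⟩
        simp only [Finset.mem_union, Finset.mem_filter, Finset.mem_univ, true_and, hk]
        omega
    _ ≤ _ := by
        rw [Finset.sum_union]
        · linarith
        · rw [Finset.disjoint_filter]
          rintro R - h1 h2
          omega

/-- The common estimate for the polymer sums in the increments. Sizes one to three carry separate
coefficient bounds, so that subtracted approximations can cancel there; sizes from four on total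
`2(2δ)³ = 16δ³`, already of third order. -/
theorem abs_sum_mul_le (hw : SmallWeights w δ) (hδ : 0 ≤ δ) (hδ' : δ ≤ 1 / 4) (k : K)
    (Λ : Finset K) (c : Finset K → ℝ) {a₁ a₂ a₃ : ℝ}
    (h₁ : ∀ R ⊆ Λ, k ∈ R → R.card = 1 → |c R| ≤ a₁)
    (h₂ : ∀ R ⊆ Λ, k ∈ R → R.card = 2 → |c R| ≤ a₂)
    (h₃ : ∀ R ⊆ Λ, k ∈ R → R.card = 3 → |c R| ≤ a₃)
    (h₄ : ∀ R ⊆ Λ, k ∈ R → 4 ≤ R.card → |c R| ≤ 2 ^ (R.card - 1))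
    (ha₁ : 0 ≤ a₁) (ha₂ : 0 ≤ a₂) (ha₃ : 0 ≤ a₃) :
    |∑ R ∈ Λ.powerset with k ∈ R, w R * c R| ≤ a₁ * δ + a₂ * δ + a₃ * δ ^ 2 + 16 * δ ^ 3 := by
  have h := hw.sum_tail_le hδ (x := 2) (by norm_num) (by linarith) (s := 4) (by norm_num) k
  have e1 := hw.one k
  have e2 := hw.two_le 2 le_rfl k
  have e3 := hw.two_le 3 (by norm_num) k
  simp only [Nat.reduceSub, pow_one] at e2 e3 h
  set b : Finset K → ℝ := fun R => if R.card = 1 then a₁ else if R.card = 2 then a₂ else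
    if R.card = 3 then a₃ else 2 ^ (R.card - 1) with hb
  have hb0 : ∀ R, 0 ≤ b R := by
    intro R
    simp only [hb]
    split_ifs <;> first | assumption | positivity
  set A : ℕ → Finset (Finset K) := fun r => Finset.univ.filter fun R => k ∈ R ∧ R.card = r with hA
  set T : Finset (Finset K) := Finset.univ.filter fun R => k ∈ R ∧ 4 ≤ R.card with hT
  have hsum : ∀ r a, (∀ R : Finset K, R.card = r → b R = a) →
      ∑ R ∈ A r, |w R| * b R = a * ∑ R ∈ A r, |w R| := by
    intro r a hr
    rw [Finset.mul_sum]
    refine Finset.sum_congr rfl fun R hR => ?_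
    rw [hr R (Finset.mem_filter.1 hR).2.2, mul_comm]
  have hsumT : ∑ R ∈ T, |w R| * b R = ∑ R ∈ T, |w R| * 2 ^ (R.card - 1) := by
    refine Finset.sum_congr rfl fun R hR => ?_
    have := (Finset.mem_filter.1 hR).2.2
    simp only [hb]
    rw [if_neg (by omega), if_neg (by omega), if_neg (by omega)]
  calc |∑ R ∈ Λ.powerset with k ∈ R, w R * c R|
      ≤ ∑ R ∈ Λ.powerset with k ∈ R, |w R| * b R := by
        refine (Finset.abs_sum_le_sum_abs _ _).trans (Finset.sum_le_sum fun R hR => ?_)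
        rw [Finset.mem_filter, Finset.mem_powerset] at hR
        rw [abs_mul]
        refine mul_le_mul_of_nonneg_left ?_ (abs_nonneg _)
        have := Finset.card_pos.2 ⟨k, hR.2⟩
        simp only [hb]
        split_ifs with i1 i2 i3
        · exact h₁ R hR.1 hR.2 i1
        · exact h₂ R hR.1 hR.2 i2
        · exact h₃ R hR.1 hR.2 i3
        · exact h₄ R hR.1 hR.2 (by omega)
    _ ≤ ∑ R ∈ A 1 ∪ (A 2 ∪ (A 3 ∪ T)), |w R| * b R := by
        refine Finset.sum_le_sum_of_subset_of_nonneg ?_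
          fun R _ _ => mul_nonneg (abs_nonneg _) (hb0 R)
        intro R hR
        have hk := (Finset.mem_filter.1 hR).2
        have := Finset.card_pos.2 ⟨k, hk⟩
        simp only [hA, hT, Finset.mem_union, Finset.mem_filter, Finset.mem_univ, true_and, hk]
        omega
    _ ≤ ∑ R ∈ A 1, |w R| * b R + (∑ R ∈ A 2, |w R| * b R + (∑ R ∈ A 3, |w R| * b R +
          ∑ R ∈ T, |w R| * b R)) := by
        have hu : ∀ s t : Finset (Finset K), ∑ R ∈ s ∪ t, |w R| * b R ≤
            ∑ R ∈ s, |w R| * b R + ∑ R ∈ t, |w R| * b R := by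
          intro s t
          rw [← Finset.sum_union_inter]
          exact le_add_of_nonneg_right
            (Finset.sum_nonneg fun R _ => mul_nonneg (abs_nonneg _) (hb0 R))
        refine (hu _ _).trans (add_le_add le_rfl ((hu _ _).trans (add_le_add le_rfl (hu _ _))))
    _ ≤ _ := by
        rw [hsum 1 a₁ fun R hR => by simp [hb, hR], hsum 2 a₂ fun R hR => by simp [hb, hR],
          hsum 3 a₃ fun R hR => by simp [hb, hR], hsumT]
        have g1 := mul_le_mul_of_nonneg_left e1 ha₁
        have g2 := mul_le_mul_of_nonneg_left e2 ha₂
        have g3 := mul_le_mul_of_nonneg_left e3 ha₃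
        have g4 : 2 * (δ * 2) ^ 3 = 16 * δ ^ 3 := by ring
        rw [g4] at h
        linarith

end SmallWeights

namespace IsPolymerGas

variable {w Z : Finset K → ℝ} {δ : ℝ}

/-- Since `5δ ≤ 1/2`, each removal of a point at most doubles `Z`; this is where the threshold
`1/10` comes from. -/
theorem sdiff_le_of_ratio (hδ' : δ ≤ 1 / 10) {Λ : Finset K} (hpos : ∀ Λ' ⊆ Λ, 0 < Z Λ')
    (h : ∀ Λ' ⊆ Λ, ∀ k ∈ Λ', |Z Λ' - Z (Λ'.erase k)| ≤ 5 * δ * Z (Λ'.erase k)) (A : Finset K) :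
    Z (Λ \ A) ≤ 2 ^ A.card * Z Λ := by
  induction A using Finset.induction_on with
  | empty => simp
  | insert a A ha ih =>
    have hs : Λ \ insert a A = (Λ \ A).erase a := by
      ext; simp; tauto
    rw [hs, Finset.card_insert_of_notMem ha, pow_succ]
    have hp := hpos _ ((Finset.erase_subset a _).trans (Finset.sdiff_subset (s := Λ) (t := A)))
    have hp' := hpos _ (Finset.sdiff_subset (s := Λ) (t := A))
    by_cases hm : a ∈ Λ \ A
    · have h1 := (abs_le.1 (h _ Finset.sdiff_subset a hm)).1
      nlinarith
    · rw [Finset.erase_eq_of_notMem hm]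
      linarith

theorem sdiff_eq_erase_sdiff {Λ R : Finset K} {k : K} (hk : k ∈ R) :
    Λ \ R = Λ.erase k \ R.erase k := by
  ext l
  simp only [Finset.mem_sdiff, Finset.mem_erase]
  constructor
  · rintro ⟨h1, h2⟩
    exact ⟨⟨fun h => h2 (h ▸ hk), h1⟩, fun h => h2 h.2⟩
  · rintro ⟨⟨h1, h2⟩, h3⟩
    exact ⟨h2, fun h => h3 ⟨h1, h⟩⟩

variable [Fintype K]

/-- A bound directly from the recursion, without positivity or division, hence also available beyond
`δ = 1/10`. -/
theorem abs_le_pow (hZ : IsPolymerGas w Z) (hw : SmallWeights w δ) (hδ : 0 ≤ δ) (hδ' : δ ≤ 1 / 2)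
    (Λ : Finset K) : |Z Λ| ≤ (1 + 3 * δ) ^ Λ.card := by
  induction Λ using Finset.strongInduction with
  | H Λ ih =>
  rcases Λ.eq_empty_or_nonempty with rfl | ⟨k, hk⟩
  · simp [hZ.empty]
  have hB : 1 ≤ 1 + 3 * δ := by linarith
  have hle : ∀ R ⊆ Λ, k ∈ R → |Z (Λ \ R)| ≤ (1 + 3 * δ) ^ (Λ.erase k).card := by
    intro R hR hkR
    refine (ih _ (Finset.sdiff_ssubset hR ⟨k, hkR⟩)).trans (pow_le_pow_right₀ hB ?_)
    refine Finset.card_le_card fun l hl => ?_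
    rw [Finset.mem_sdiff] at hl
    exact Finset.mem_erase.2 ⟨fun h => hl.2 (h ▸ hkR), hl.1⟩
  rw [hZ.step Λ k hk, ← Finset.card_erase_add_one hk, pow_succ]
  refine (abs_add_le _ _).trans ?_
  have h1 := ih _ (Finset.erase_ssubset hk)
  have h2 : |∑ R ∈ Λ.powerset with k ∈ R, w R * Z (Λ \ R)| ≤
      (3 * δ) * (1 + 3 * δ) ^ (Λ.erase k).card := by
    calc _ ≤ ∑ R ∈ Λ.powerset with k ∈ R, |w R| * (1 + 3 * δ) ^ (Λ.erase k).card := by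
          refine (Finset.abs_sum_le_sum_abs _ _).trans (Finset.sum_le_sum fun R hR => ?_)
          rw [Finset.mem_filter, Finset.mem_powerset] at hR
          rw [abs_mul]
          exact mul_le_mul_of_nonneg_left (hle R hR.1 hR.2) (abs_nonneg _)
      _ ≤ _ := by
          rw [← Finset.sum_mul]
          exact mul_le_mul_of_nonneg_right (hw.sum_abs_le hδ hδ' k Λ) (by positivity)
  linarith

/-- Both claims must be proved together: positivity on smaller sets permits division by `Z (Λ.erase
k)`, their ratio bounds control `Z (Λ \ R)` by doubling, and the new ratio bound with `5δ ≤ 1/2`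
returns positivity. -/
theorem pos_and_ratio (hZ : IsPolymerGas w Z) (hw : SmallWeights w δ) (hδ : 0 ≤ δ)
    (hδ' : δ ≤ 1 / 10) (Λ : Finset K) :
    0 < Z Λ ∧ ∀ k ∈ Λ, |Z Λ - Z (Λ.erase k)| ≤ 5 * δ * Z (Λ.erase k) := by
  induction Λ using Finset.strongInduction with
  | H Λ ih =>
  have key : ∀ k ∈ Λ, |Z Λ - Z (Λ.erase k)| ≤ 5 * δ * Z (Λ.erase k) := by
    intro k hk
    have hsub : ∀ Λ' ⊆ Λ.erase k, Λ' ⊂ Λ := fun Λ' h => h.trans_ssubset (Finset.erase_ssubset hk)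
    have hp := (ih _ (Finset.erase_ssubset hk)).1
    have hc : ∀ R ⊆ Λ, k ∈ R → |Z (Λ \ R) / Z (Λ.erase k)| ≤ 2 ^ (R.card - 1) := by
      intro R hR hkR
      have h0 := (ih _ (Finset.sdiff_ssubset hR ⟨k, hkR⟩)).1
      rw [abs_of_pos (div_pos h0 hp), div_le_iff₀ hp, sdiff_eq_erase_sdiff hkR,
        ← Finset.card_erase_of_mem hkR]
      exact sdiff_le_of_ratio hδ' (fun Λ' h => (ih Λ' (hsub Λ' h)).1)
        (fun Λ' h => (ih Λ' (hsub Λ' h)).2) _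
    -- The doubling bounds `1, 2, 4` give `δ + 2δ + 4δ² + 16δ³`, which is below `5δ` for `δ ≤ 1/10`.
    have h1 := hw.abs_sum_mul_le hδ (by linarith) k Λ (fun R => Z (Λ \ R) / Z (Λ.erase k))
      (a₁ := 1) (a₂ := 2) (a₃ := 4)
      (fun R hR hkR hc1 => by simpa [hc1] using hc R hR hkR)
      (fun R hR hkR hc1 => by simpa [hc1] using hc R hR hkR)
      (fun R hR hkR hc1 => by have := hc R hR hkR; rw [hc1] at this; norm_num at this ⊢; exact this)
      (fun R hR hkR _ => hc R hR hkR) (by norm_num) (by norm_num) (by norm_num)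
    have h2 : Z Λ - Z (Λ.erase k) =
        (∑ R ∈ Λ.powerset with k ∈ R, w R * (Z (Λ \ R) / Z (Λ.erase k))) * Z (Λ.erase k) := by
      rw [hZ.step Λ k hk, Finset.sum_mul, add_sub_cancel_left]
      refine Finset.sum_congr rfl fun R _ => ?_
      field_simp
    rw [h2, abs_mul, abs_of_pos hp]
    refine mul_le_mul_of_nonneg_right (h1.trans ?_) hp.le
    nlinarith [mul_nonneg hδ hδ, mul_nonneg hδ (mul_nonneg hδ hδ)]
  refine ⟨?_, key⟩
  rcases Λ.eq_empty_or_nonempty with rfl | ⟨k, hk⟩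
  · simp [hZ.empty]
  · have h1 := (abs_le.1 (key k hk)).1
    have hp := (ih _ (Finset.erase_ssubset hk)).1
    nlinarith

theorem pos (hZ : IsPolymerGas w Z) (hw : SmallWeights w δ) (hδ : 0 ≤ δ)
    (hδ' : δ ≤ 1 / 10) (Λ : Finset K) : 0 < Z Λ := (hZ.pos_and_ratio hw hδ hδ' Λ).1

theorem sdiff_le (hZ : IsPolymerGas w Z) (hw : SmallWeights w δ) (hδ : 0 ≤ δ)
    (hδ' : δ ≤ 1 / 10) (Λ A : Finset K) : Z (Λ \ A) ≤ 2 ^ A.card * Z Λ :=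
  sdiff_le_of_ratio hδ' (fun Λ' _ => hZ.pos hw hδ hδ' Λ')
    (fun Λ' _ => (hZ.pos_and_ratio hw hδ hδ' Λ').2) A

/-- Remove the points of `A` one at a time: each step costs `5δ` times a partition function that is
at most `2 ^ A.card * Z Λ`. -/
theorem abs_sdiff_sub_le (hZ : IsPolymerGas w Z) (hw : SmallWeights w δ) (hδ : 0 ≤ δ)
    (hδ' : δ ≤ 1 / 10) (Λ A : Finset K) :
    |Z (Λ \ A) - Z Λ| ≤ 5 * δ * A.card * 2 ^ A.card * Z Λ := by
  induction A using Finset.induction_on with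
  | empty => simp
  | insert a A ha ih =>
    have hs : Λ \ insert a A = (Λ \ A).erase a := by
      ext; simp; tauto
    have h2 := hZ.sdiff_le hw hδ hδ' Λ (insert a A)
    have hp := hZ.pos hw hδ hδ' Λ
    have hstep : |Z (Λ \ insert a A) - Z (Λ \ A)| ≤ 5 * δ * Z (Λ \ insert a A) := by
      by_cases hm : a ∈ Λ \ A
      · rw [hs, abs_sub_comm]
        exact (hZ.pos_and_ratio hw hδ hδ' _).2 a hm
      · rw [hs, Finset.erase_eq_of_notMem hm, sub_self, abs_zero]
        exact mul_nonneg (by positivity) (hZ.pos hw hδ hδ' _).le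
    have h3 := abs_sub_le (Z (Λ \ insert a A)) (Z (Λ \ A)) (Z Λ)
    rw [Finset.card_insert_of_notMem ha, pow_succ] at *
    push_cast
    have h4 := mul_le_mul_of_nonneg_left h2 (by positivity : 0 ≤ 5 * δ)
    have h5 : 0 ≤ 5 * δ * A.card * 2 ^ A.card * Z Λ := by positivity
    nlinarith

/-- The relative increment of the partition function at `k`. -/
theorem div_erase_sub_one (hZ : IsPolymerGas w Z) (hw : SmallWeights w δ) (hδ : 0 ≤ δ)
    (hδ' : δ ≤ 1 / 10) {Λ : Finset K} {k : K} (hk : k ∈ Λ) :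
    Z Λ / Z (Λ.erase k) - 1 =
      ∑ R ∈ Λ.powerset with k ∈ R, w R * (Z (Λ \ R) / Z (Λ.erase k)) := by
  have hp := hZ.pos hw hδ hδ' (Λ.erase k)
  rw [hZ.step Λ k hk, add_div, div_self hp.ne', add_sub_cancel_left, Finset.sum_div]
  exact Finset.sum_congr rfl fun R _ => by rw [mul_div_assoc]

end IsPolymerGas

end PolymerGas

/-! ### Expansion of `log Z` to second order. -/

section PolymerGas

variable {K : Type*} [DecidableEq K]

/-- The polymers of size one or two inside `Λ`. -/
def smallPolymers (Λ : Finset K) : Finset (Finset K) :=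
  Λ.powerset.filter fun R => R.card = 1 ∨ R.card = 2

/-- The first order of the expansion of `log Z Λ`. -/
def firstOrder (w : Finset K → ℝ) (Λ : Finset K) : ℝ := ∑ R ∈ smallPolymers Λ, w R

/-- The second order of the expansion of `log Z Λ`. -/
noncomputable def secondOrder (w : Finset K → ℝ) (Λ : Finset K) : ℝ :=
  1 / 2 * ∑ R₁ ∈ smallPolymers Λ, ∑ R₂ ∈ smallPolymers Λ,
      (if Disjoint R₁ R₂ then 0 else -1) * w R₁ * w R₂
    + ∑ R ∈ Λ.powerset with R.card = 3, w R

/-- The increment of `firstOrder` at `k`. -/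
def smallSum (w : Finset K → ℝ) (Λ : Finset K) (k : K) : ℝ := ∑ R ∈ smallPolymers Λ with k ∈ R, w R

/-- The sum of the weights of the small polymers in `Λ` that meet `R`. -/
def meetSum (w : Finset K → ℝ) (Λ R : Finset K) : ℝ :=
  ∑ R' ∈ smallPolymers Λ, if Disjoint R R' then 0 else w R'

theorem smallPolymers_erase (Λ : Finset K) (k : K) :
    smallPolymers (Λ.erase k) = (smallPolymers Λ).filter fun R => k ∉ R := by
  ext R
  simp only [smallPolymers, Finset.mem_filter, Finset.mem_powerset, Finset.subset_erase]
  tauto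

theorem firstOrder_sub_erase (w : Finset K → ℝ) (Λ : Finset K) (k : K) :
    firstOrder w Λ - firstOrder w (Λ.erase k) = smallSum w Λ k := by
  rw [firstOrder, firstOrder, smallSum, smallPolymers_erase,
    ← Finset.sum_filter_add_sum_filter_not (smallPolymers Λ) (fun R => k ∈ R), add_sub_cancel_right]

/-- Sort pairs of polymers by which members contain `k`. If both do, they meet, giving a square that
will match the quadratic term of the logarithm; if exactly one does, the two symmetric cases give
the mixed term, which corrects the ratio `Z (Λ \ R) / Z (Λ.erase k)`. -/
theorem secondOrder_sub_erase (w : Finset K → ℝ) (Λ : Finset K) (k : K) :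
    secondOrder w Λ - secondOrder w (Λ.erase k) =
      ∑ R ∈ Λ.powerset with k ∈ R ∧ R.card = 3, w R
        - ∑ R ∈ smallPolymers Λ with k ∈ R, w R * meetSum w (Λ.erase k) R
        - smallSum w Λ k ^ 2 / 2 := by
  have h3 : ∑ R ∈ Λ.powerset with R.card = 3, w R =
      ∑ R ∈ Λ.powerset with k ∈ R ∧ R.card = 3, w R +
        ∑ R ∈ (Λ.erase k).powerset with R.card = 3, w R := by
    rw [← Finset.sum_filter_add_sum_filter_not _ (fun R => k ∈ R), Finset.filter_filter,
      Finset.filter_filter]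
    congr 1
    · refine Finset.sum_congr ?_ fun _ _ => rfl
      ext R
      simp only [Finset.mem_filter]
      tauto
    · refine Finset.sum_congr ?_ fun _ _ => rfl
      ext R
      simp only [Finset.mem_filter, Finset.mem_powerset, Finset.subset_erase]
      tauto
  set c : Finset K → Finset K → ℝ := fun R₁ R₂ =>
    (if Disjoint R₁ R₂ then 0 else -1) * w R₁ * w R₂ with hc
  have hcomm : ∀ R₁ R₂, c R₁ R₂ = c R₂ R₁ := by
    intro R₁ R₂
    simp only [hc, disjoint_comm (a := R₁)]
    ring
  set P := smallPolymers Λ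
  have hsplit : ∀ g : Finset K → ℝ, ∑ R ∈ P, g R =
      ∑ R ∈ P with k ∈ R, g R + ∑ R ∈ smallPolymers (Λ.erase k), g R := by
    intro g
    rw [smallPolymers_erase, Finset.sum_filter_add_sum_filter_not]
  have hsq : ∑ R₁ ∈ P with k ∈ R₁, ∑ R₂ ∈ P with k ∈ R₂, c R₁ R₂ = -smallSum w Λ k ^ 2 := by
    rw [smallSum, sq, Finset.sum_mul_sum, ← Finset.sum_neg_distrib]
    refine Finset.sum_congr rfl fun R₁ h₁ => ?_
    rw [← Finset.sum_neg_distrib]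
    refine Finset.sum_congr rfl fun R₂ h₂ => ?_
    have : ¬ Disjoint R₁ R₂ := fun h =>
      Finset.disjoint_left.1 h (Finset.mem_filter.1 h₁).2 (Finset.mem_filter.1 h₂).2
    simp only [hc, if_neg this]
    ring
  have hmix : ∑ R₁ ∈ P with k ∈ R₁, ∑ R₂ ∈ smallPolymers (Λ.erase k), c R₁ R₂ =
      -∑ R ∈ P with k ∈ R, w R * meetSum w (Λ.erase k) R := by
    rw [← Finset.sum_neg_distrib]
    refine Finset.sum_congr rfl fun R₁ _ => ?_
    rw [meetSum, Finset.mul_sum, ← Finset.sum_neg_distrib]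
    refine Finset.sum_congr rfl fun R₂ _ => ?_
    simp only [hc]
    split_ifs <;> ring
  have hmix' : ∑ R₁ ∈ smallPolymers (Λ.erase k), ∑ R₂ ∈ P with k ∈ R₂, c R₁ R₂ =
      -∑ R ∈ P with k ∈ R, w R * meetSum w (Λ.erase k) R := by
    rw [← hmix, Finset.sum_comm]
    exact Finset.sum_congr rfl fun R₁ _ => Finset.sum_congr rfl fun R₂ _ => hcomm _ _
  have hdouble : ∑ R₁ ∈ P, ∑ R₂ ∈ P, c R₁ R₂ =
      -smallSum w Λ k ^ 2 - 2 * ∑ R ∈ P with k ∈ R, w R * meetSum w (Λ.erase k) R +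
        ∑ R₁ ∈ smallPolymers (Λ.erase k), ∑ R₂ ∈ smallPolymers (Λ.erase k), c R₁ R₂ := by
    rw [hsplit, Finset.sum_congr rfl fun R₁ _ => hsplit (c R₁),
      Finset.sum_congr (s₁ := smallPolymers (Λ.erase k)) rfl fun R₁ _ => hsplit (c R₁),
      Finset.sum_add_distrib, Finset.sum_add_distrib, hsq, hmix, hmix']
    ring
  rw [secondOrder, secondOrder, h3, hdouble]
  ring

theorem firstOrder_empty {K : Type*} (w : Finset K → ℝ) : firstOrder w ∅ = 0 := by
  refine Finset.sum_eq_zero fun R hR => ?_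
  rw [smallPolymers, Finset.mem_filter, Finset.mem_powerset, Finset.subset_empty] at hR
  simp [hR.1] at hR

theorem secondOrder_empty (w : Finset K → ℝ) : secondOrder w ∅ = 0 := by
  have h : smallPolymers (∅ : Finset K) = ∅ := by
    refine Finset.eq_empty_of_forall_notMem fun R hR => ?_
    rw [smallPolymers, Finset.mem_filter, Finset.mem_powerset, Finset.subset_empty] at hR
    simp [hR.1] at hR
  simp [secondOrder, h, Finset.filter_singleton]

theorem meetSum_pair (w : Finset K → ℝ) {Λ : Finset K} {k l : K} :
    meetSum w (Λ.erase k) {k, l} = smallSum w (Λ.erase k) l := by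
  rw [meetSum, smallSum, Finset.sum_filter]
  refine Finset.sum_congr rfl fun R hR => ?_
  rw [smallPolymers_erase, Finset.mem_filter] at hR
  simp [hR.2]

theorem meetSum_singleton (w : Finset K → ℝ) {Λ : Finset K} {k : K} :
    meetSum w (Λ.erase k) {k} = 0 := by
  refine Finset.sum_eq_zero fun R hR => ?_
  rw [smallPolymers_erase, Finset.mem_filter] at hR
  simp [hR.2]

theorem exists_eq_pair {R : Finset K} {k : K} (hk : k ∈ R) (hR : R.card = 2) :
    ∃ l, l ≠ k ∧ R = {k, l} := by
  obtain ⟨a, b, hab, rfl⟩ := Finset.card_eq_two.1 hR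
  rcases Finset.mem_insert.1 hk with rfl | h
  · exact ⟨b, hab.symm, rfl⟩
  · rw [Finset.mem_singleton] at h
    subst h
    exact ⟨a, hab, Finset.pair_comm _ _⟩

variable [Fintype K] {w Z : Finset K → ℝ} {δ : ℝ}

theorem smallSum_eq {K : Type*} [DecidableEq K] (w : Finset K → ℝ) (Λ : Finset K) (k : K) :
    smallSum w Λ k = ∑ R ∈ Λ.powerset with k ∈ R, w R * if R.card ≤ 2 then 1 else 0 := by
  simp only [mul_ite, mul_one, mul_zero]
  rw [← Finset.sum_filter, smallSum, smallPolymers, Finset.filter_filter, Finset.filter_filter]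
  refine Finset.sum_congr ?_ fun _ _ => rfl
  ext R
  simp only [Finset.mem_filter, Finset.mem_powerset]
  refine and_congr_right fun _ => ?_
  constructor
  · rintro ⟨h1, h2⟩
    exact ⟨h2, by omega⟩
  · rintro ⟨h1, h2⟩
    have := Finset.card_pos.2 ⟨k, h1⟩
    exact ⟨by omega, h1⟩

/-- Adding back the quadratic term of the logarithm leaves a sum linear in the weights of polymers
through `k`. Its coefficient `1 - meetSum` approximates the ratio in the exact recursion, so the two
sums can be compared term by term. -/
theorem secondOrder_sub_erase_eq {K : Type*} [DecidableEq K] (w : Finset K → ℝ) (Λ : Finset K)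
    (k : K) :
    smallSum w Λ k + (secondOrder w Λ - secondOrder w (Λ.erase k)) + smallSum w Λ k ^ 2 / 2 =
      ∑ R ∈ Λ.powerset with k ∈ R, w R * ((if R.card ≤ 3 then 1 else 0) -
        if R.card ≤ 2 then meetSum w (Λ.erase k) R else 0) := by
  rw [secondOrder_sub_erase, add_assoc, sub_add_cancel, smallSum_eq]
  have h3 : ∑ R ∈ Λ.powerset with k ∈ R ∧ R.card = 3, w R =
      ∑ R ∈ Λ.powerset with k ∈ R, w R * if R.card = 3 then 1 else 0 := by
    simp only [mul_ite, mul_one, mul_zero]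
    rw [← Finset.sum_filter, Finset.filter_filter]
  have h2 : ∑ R ∈ smallPolymers Λ with k ∈ R, w R * meetSum w (Λ.erase k) R =
      ∑ R ∈ Λ.powerset with k ∈ R, w R * if R.card ≤ 2 then meetSum w (Λ.erase k) R else 0 := by
    have := smallSum_eq (fun R => w R * meetSum w (Λ.erase k) R) Λ k
    rw [smallSum] at this
    rw [this]
    refine Finset.sum_congr rfl fun R _ => ?_
    split_ifs <;> ring
  rw [h3, h2, ← add_sub_assoc, ← Finset.sum_add_distrib, ← Finset.sum_sub_distrib]
  refine Finset.sum_congr rfl fun R hR => ?_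
  split_ifs <;> first | omega | ring

theorem SmallWeights.abs_smallSum_le (hw : SmallWeights w δ) (Λ : Finset K) (k : K) :
    |smallSum w Λ k| ≤ 2 * δ := by
  have e1 := hw.one k
  have e2 := hw.two_le 2 le_rfl k
  rw [smallSum]
  calc _ ≤ ∑ R ∈ smallPolymers Λ with k ∈ R, |w R| := Finset.abs_sum_le_sum_abs _ _
    _ ≤ ∑ R ∈ ((Finset.univ.filter fun R : Finset K => k ∈ R ∧ R.card = 1) ∪
          Finset.univ.filter fun R : Finset K => k ∈ R ∧ R.card = 2), |w R| := by
        refine Finset.sum_le_sum_of_subset_of_nonneg ?_ fun _ _ _ => abs_nonneg _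
        intro R
        simp only [smallPolymers, Finset.mem_union, Finset.mem_filter, Finset.mem_univ]
        tauto
    _ ≤ _ := by
        rw [Finset.sum_union]
        · simp only [Nat.reduceSub, pow_one] at e2
          linarith
        · rw [Finset.disjoint_filter]
          rintro R - h1 h2
          omega

theorem SmallWeights.abs_firstOrder_le (hw : SmallWeights w δ) (Λ : Finset K) :
    |firstOrder w Λ| ≤ Λ.card * (2 * δ) :=
  abs_le_card_mul (firstOrder_empty w)
    (fun Λ k _ => by rw [firstOrder_sub_erase]; exact hw.abs_smallSum_le Λ k) Λ

theorem SmallWeights.abs_meetSum_le (hw : SmallWeights w δ) (hδ : 0 ≤ δ) {Λ R : Finset K} {k : K}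
    (hk : k ∈ R) (hR : R.card ≤ 2) : |meetSum w (Λ.erase k) R| ≤ 2 * δ := by
  have := Finset.card_pos.2 ⟨k, hk⟩
  obtain h | h : R.card = 1 ∨ R.card = 2 := by omega
  · obtain ⟨l, rfl⟩ := Finset.card_eq_one.1 h
    rw [Finset.mem_singleton] at hk
    subst hk
    rw [meetSum_singleton, abs_zero]
    positivity
  · obtain ⟨l, -, rfl⟩ := exists_eq_pair hk h
    rw [meetSum_pair]
    exact hw.abs_smallSum_le _ _

/-- A deliberately crude linear bound, for the range where `δ` is bounded below. -/
theorem SmallWeights.abs_secondOrder_le (hw : SmallWeights w δ) (hδ : 0 ≤ δ) (hδ' : δ ≤ 1 / 4)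
    (Λ : Finset K) : |secondOrder w Λ| ≤ Λ.card * (7 * δ) := by
  refine abs_le_card_mul (secondOrder_empty w) (fun Λ k hk => ?_) Λ
  have h := secondOrder_sub_erase_eq w Λ k
  have hu := hw.abs_smallSum_le Λ k
  have hb := hw.abs_sum_mul_le hδ hδ' k Λ (fun R => ((if R.card ≤ 3 then 1 else 0) -
    if R.card ≤ 2 then meetSum w (Λ.erase k) R else 0)) (a₁ := 1 + 2 * δ) (a₂ := 1 + 2 * δ) (a₃ := 1)
    ?_ ?_ ?_ ?_ (by positivity) (by positivity) (by positivity)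
  · rw [← h] at hb
    have hsq : smallSum w Λ k ^ 2 ≤ (2 * δ) ^ 2 := sq_le_sq' (abs_le.1 hu).1 (abs_le.1 hu).2
    have hsq0 := sq_nonneg (smallSum w Λ k)
    rw [abs_le] at *
    have h2 : δ ^ 2 ≤ δ * (1 / 4) := by rw [sq]; exact mul_le_mul_of_nonneg_left hδ' hδ
    have h3 : δ ^ 3 ≤ δ * (1 / 16) := by
      nlinarith [mul_nonneg hδ hδ]
    constructor <;> nlinarith
  · intro R _ hk hR
    have := hw.abs_meetSum_le hδ (Λ := Λ) hk (by omega : R.card ≤ 2)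
    simp only [hR]
    rw [if_pos (by norm_num), if_pos (by norm_num)]
    exact (abs_sub _ _).trans (by rw [abs_one]; linarith)
  · intro R _ hk hR
    have := hw.abs_meetSum_le hδ (Λ := Λ) hk (by omega : R.card ≤ 2)
    simp only [hR]
    rw [if_pos (by norm_num), if_pos (by norm_num)]
    exact (abs_sub _ _).trans (by rw [abs_one]; linarith)
  · intro R _ _ hR
    simp [hR]
  · intro R _ _ hR
    rw [if_neg (by omega), if_neg (by omega)]
    simp

namespace IsPolymerGas

theorem abs_div_sub_one_le (hZ : IsPolymerGas w Z) (hw : SmallWeights w δ) (hδ : 0 ≤ δ)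
    (hδ' : δ ≤ 1 / 10) {Λ : Finset K} {k : K} (hk : k ∈ Λ) :
    |Z Λ / Z (Λ.erase k) - 1| ≤ 5 * δ := by
  have hp := hZ.pos hw hδ hδ' (Λ.erase k)
  rw [div_sub_one hp.ne', abs_div, abs_of_pos hp, div_le_iff₀ hp]
  exact (hZ.pos_and_ratio hw hδ hδ' Λ).2 k hk

theorem abs_sdiff_div_sub_one_le (hZ : IsPolymerGas w Z) (hw : SmallWeights w δ) (hδ : 0 ≤ δ)
    (hδ' : δ ≤ 1 / 10) {Λ R : Finset K} {k : K} (hk : k ∈ R) :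
    |Z (Λ \ R) / Z (Λ.erase k) - 1| ≤ 5 * δ * (R.card - 1 : ℕ) * 2 ^ (R.card - 1) := by
  have hp := hZ.pos hw hδ hδ' (Λ.erase k)
  rw [div_sub_one hp.ne', abs_div, abs_of_pos hp, div_le_iff₀ hp, sdiff_eq_erase_sdiff hk,
    ← Finset.card_erase_of_mem hk]
  exact hZ.abs_sdiff_sub_le hw hδ hδ' _ _

theorem abs_sdiff_div_le (hZ : IsPolymerGas w Z) (hw : SmallWeights w δ) (hδ : 0 ≤ δ)
    (hδ' : δ ≤ 1 / 10) {Λ R : Finset K} {k : K} (hk : k ∈ R) :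
    |Z (Λ \ R) / Z (Λ.erase k)| ≤ 2 ^ (R.card - 1) := by
  have hp := hZ.pos hw hδ hδ' (Λ.erase k)
  rw [abs_div, abs_of_pos hp, div_le_iff₀ hp, abs_of_pos (hZ.pos hw hδ hδ' _),
    sdiff_eq_erase_sdiff hk, ← Finset.card_erase_of_mem hk]
  exact hZ.sdiff_le hw hδ hδ' _ _

/-- The coefficient error vanishes for singletons, is at most `10δ` for pairs and is bounded by `4`
for triples; the total `14δ² + 16δ³` is at most `16δ²`. -/
theorem abs_div_sub_one_sub_smallSum_le (hZ : IsPolymerGas w Z) (hw : SmallWeights w δ) (hδ : 0 ≤ δ)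
    (hδ' : δ ≤ 1 / 10) {Λ : Finset K} {k : K} (hk : k ∈ Λ) :
    |Z Λ / Z (Λ.erase k) - 1 - smallSum w Λ k| ≤ 16 * δ ^ 2 := by
  rw [hZ.div_erase_sub_one hw hδ hδ' hk, smallSum_eq, ← Finset.sum_sub_distrib]
  simp only [← mul_sub]
  refine (hw.abs_sum_mul_le hδ (by linarith) k Λ _ (a₁ := 0) (a₂ := 10 * δ) (a₃ := 4)
    ?_ ?_ ?_ ?_ (by positivity) (by positivity) (by positivity)).trans ?_
  · intro R _ hk hR
    have := hZ.abs_sdiff_div_sub_one_le hw hδ hδ' (Λ := Λ) hk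
    simpa [hR] using this
  · intro R _ hk hR
    have := hZ.abs_sdiff_div_sub_one_le hw hδ hδ' (Λ := Λ) hk
    simp only [hR] at this ⊢
    norm_num at this ⊢
    linarith
  · intro R _ hk hR
    have := hZ.abs_sdiff_div_le hw hδ hδ' (Λ := Λ) hk
    simp only [hR] at this ⊢
    norm_num at this ⊢
    exact this
  · intro R _ hk hR
    have := hZ.abs_sdiff_div_le hw hδ hδ' (Λ := Λ) hk
    rw [if_neg (by omega), sub_zero]
    exact this
  · nlinarith [mul_nonneg hδ hδ]

/-- A bootstrap: for a pair `{k, l}` the coefficient is the inverse of a one-point ratio at `l`,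
known to first order by the preceding estimate. Triples need only the zeroth-order ratio. -/
theorem abs_div_sub_one_sub_secondOrder_le (hZ : IsPolymerGas w Z) (hw : SmallWeights w δ)
    (hδ : 0 ≤ δ) (hδ' : δ ≤ 1 / 10) {Λ : Finset K} {k : K} (hk : k ∈ Λ) :
    |Z Λ / Z (Λ.erase k) - 1 - (smallSum w Λ k + (secondOrder w Λ - secondOrder w (Λ.erase k)) +
      smallSum w Λ k ^ 2 / 2)| ≤ 122 * δ ^ 3 := by
  rw [hZ.div_erase_sub_one hw hδ hδ' hk, secondOrder_sub_erase_eq, ← Finset.sum_sub_distrib]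
  simp only [← mul_sub]
  refine (hw.abs_sum_mul_le hδ (by linarith) k Λ _ (a₁ := 0) (a₂ := 66 * δ ^ 2) (a₃ := 40 * δ)
    ?_ ?_ ?_ ?_ (by positivity) (by positivity) (by positivity)).trans ?_
  · intro R _ hk hR
    have := hZ.abs_sdiff_div_sub_one_le hw hδ hδ' (Λ := Λ) hk
    obtain ⟨l, rfl⟩ := Finset.card_eq_one.1 hR
    rw [Finset.mem_singleton] at hk
    subst hk
    rw [meetSum_singleton]
    simpa using this
  · intro R hRΛ hk hR
    obtain ⟨l, hl, rfl⟩ := exists_eq_pair hk hR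
    have hlΛ : l ∈ Λ.erase k := Finset.mem_erase.2 ⟨hl, hRΛ (by simp)⟩
    have h1 := hZ.abs_div_sub_one_sub_smallSum_le hw hδ hδ' hlΛ
    have h2 := hZ.abs_div_sub_one_le hw hδ hδ' hlΛ
    have hp := hZ.pos hw hδ hδ' (Λ.erase k)
    have hp' := hZ.pos hw hδ hδ' ((Λ.erase k).erase l)
    have hs : Λ \ {k, l} = (Λ.erase k).erase l := by
      ext; simp; tauto
    rw [meetSum_pair, if_pos (by rw [hR]; norm_num), if_pos (by rw [hR]), hs]
    set x := Z (Λ.erase k) / Z ((Λ.erase k).erase l) - 1 with hx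
    have hx1 : Z ((Λ.erase k).erase l) / Z (Λ.erase k) = 1 / (1 + x) := by
      rw [hx, add_sub_cancel, one_div_div]
    have hx2 : 1 / 2 ≤ 1 + x := by
      have := (abs_le.1 h2).1
      linarith
    rw [hx1]
    -- The inversion error is at most `50δ²` and the first-order error `16δ²`, hence `66δ²` for
    -- pairs; with `40δ` for triples the total is `(66 + 40 + 16)δ³ = 122δ³`.
    have e : 1 / (1 + x) - (1 - smallSum w (Λ.erase k) l) =
        x ^ 2 / (1 + x) - (x - smallSum w (Λ.erase k) l) := by
      field_simp
      ring
    rw [e]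
    have h3 : x ^ 2 / (1 + x) ≤ 50 * δ ^ 2 := by
      rw [div_le_iff₀ (by linarith)]
      have := sq_le_sq' (abs_le.1 h2).1 (abs_le.1 h2).2
      nlinarith [sq_nonneg δ]
    have h4 : 0 ≤ x ^ 2 / (1 + x) := by positivity
    rw [abs_le] at h1 ⊢
    constructor <;> linarith
  · intro R _ hk hR
    have := hZ.abs_sdiff_div_sub_one_le hw hδ hδ' (Λ := Λ) hk
    simp only [hR] at this ⊢
    norm_num at this ⊢
    linarith
  · intro R _ hk hR
    have := hZ.abs_sdiff_div_le hw hδ hδ' (Λ := Λ) hk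
    rw [if_neg (by omega), if_neg (by omega), sub_zero, sub_zero]
    exact this
  · nlinarith [mul_nonneg hδ hδ]

/-- Taylor expansion of `log (1 + x)` at the relative increment `x`, with `|x| ≤ 5δ ≤ 1/2`. In the
quadratic term `x` may be replaced by its first order `u`, since `x² - u² = (x - u)(x + u)` is
`O(δ³)`. -/
theorem abs_log_sub_log_sub_le (hZ : IsPolymerGas w Z) (hw : SmallWeights w δ)
    (hδ : 0 ≤ δ) (hδ' : δ ≤ 1 / 10) {Λ : Finset K} {k : K} (hk : k ∈ Λ) :
    |Real.log (Z Λ) - Real.log (Z (Λ.erase k)) - smallSum w Λ k| ≤ 66 * δ ^ 2 ∧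
    |Real.log (Z Λ) - Real.log (Z (Λ.erase k)) -
      (smallSum w Λ k + (secondOrder w Λ - secondOrder w (Λ.erase k)))| ≤ 500 * δ ^ 3 := by
  have hp := hZ.pos hw hδ hδ' (Λ.erase k)
  have hp' := hZ.pos hw hδ hδ' Λ
  have h1 := hZ.abs_div_sub_one_le hw hδ hδ' hk
  have h2 := hZ.abs_div_sub_one_sub_smallSum_le hw hδ hδ' hk
  have h3 := hZ.abs_div_sub_one_sub_secondOrder_le hw hδ hδ' hk
  have hu := hw.abs_smallSum_le Λ k
  rw [← Real.log_div hp'.ne' hp.ne']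
  set x := Z Λ / Z (Λ.erase k) - 1 with hx
  have hx1 : Z Λ / Z (Λ.erase k) = 1 + x := by rw [hx]; ring
  rw [hx1]
  set u := smallSum w Λ k
  have hx2 : |x| ≤ 1 / 2 := h1.trans (by linarith)
  have hx3 : (0 : ℝ) < 1 - |x| := by linarith
  have l1 := Real.abs_log_sub_add_sum_range_le (x := -x) (by rw [abs_neg]; linarith) 1
  have l2 := Real.abs_log_sub_add_sum_range_le (x := -x) (by rw [abs_neg]; linarith) 2
  simp only [Finset.sum_range_succ, Finset.sum_range_zero, abs_neg, sub_neg_eq_add] at l1 l2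
  have b1 : |x| ^ (1 + 1) / (1 - |x|) ≤ 50 * δ ^ 2 := by
    rw [div_le_iff₀ hx3]
    have := pow_le_pow_left₀ (abs_nonneg x) h1 2
    norm_num at this ⊢
    nlinarith [mul_nonneg (sq_nonneg δ) (sub_nonneg.2 hx2)]
  have b2 : |x| ^ (2 + 1) / (1 - |x|) ≤ 250 * δ ^ 3 := by
    rw [div_le_iff₀ hx3]
    have := pow_le_pow_left₀ (abs_nonneg x) h1 3
    have h0 : 0 ≤ δ ^ 3 := by positivity
    norm_num at this ⊢
    nlinarith [mul_nonneg h0 (sub_nonneg.2 hx2)]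
  have b3 : |x ^ 2 - u ^ 2| ≤ 16 * δ ^ 2 * (7 * δ) := by
    rw [show x ^ 2 - u ^ 2 = (x - u) * (x + u) by ring, abs_mul]
    refine mul_le_mul h2 ((abs_add_le _ _).trans (by linarith)) (abs_nonneg _) (by positivity)
  have l1' := l1.trans b1
  have l2' := l2.trans b2
  have hd3 : 0 ≤ δ ^ 3 := by positivity
  norm_num at l1' l2'
  rw [abs_le] at l1' l2' b3 h2 h3 ⊢
  rw [abs_le]
  refine ⟨⟨?_, ?_⟩, ?_, ?_⟩ <;> linarith

theorem abs_log_sub_firstOrder_le (hZ : IsPolymerGas w Z) (hw : SmallWeights w δ)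
    (hδ : 0 ≤ δ) (hδ' : δ ≤ 1 / 10) (Λ : Finset K) :
    |Real.log (Z Λ) - firstOrder w Λ| ≤ Λ.card * (66 * δ ^ 2) := by
  refine abs_le_card_mul (f := fun Λ => Real.log (Z Λ) - firstOrder w Λ)
    (by simp [hZ.empty, firstOrder_empty]) (fun Λ k hk => ?_) Λ
  have := (hZ.abs_log_sub_log_sub_le hw hδ hδ' hk).1
  rw [← firstOrder_sub_erase] at this
  convert this using 2
  ring

theorem abs_log_sub_secondOrder_le (hZ : IsPolymerGas w Z) (hw : SmallWeights w δ)
    (hδ : 0 ≤ δ) (hδ' : δ ≤ 1 / 10) (Λ : Finset K) :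
    |Real.log (Z Λ) - (firstOrder w Λ + secondOrder w Λ)| ≤ Λ.card * (500 * δ ^ 3) := by
  refine abs_le_card_mul (f := fun Λ => Real.log (Z Λ) - (firstOrder w Λ + secondOrder w Λ))
    (by simp [hZ.empty, firstOrder_empty, secondOrder_empty]) (fun Λ k hk => ?_) Λ
  have := (hZ.abs_log_sub_log_sub_le hw hδ hδ' hk).2
  rw [← firstOrder_sub_erase] at this
  convert this using 2
  ring

/-- The three orders of the expansion, for a partition function bounded below by one. -/
theorem abs_log_le (hZ : IsPolymerGas w Z) (hw : SmallWeights w δ) (hδ : 0 ≤ δ) (hδ' : δ ≤ 1 / 6)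
    {Λ : Finset K} (h1 : 1 ≤ Z Λ) :
    |Real.log (Z Λ)| ≤ 12000 * Λ.card * δ ∧
    |Real.log (Z Λ) - firstOrder w Λ| ≤ 12000 * Λ.card * δ ^ 2 ∧
    |Real.log (Z Λ) - (firstOrder w Λ + secondOrder w Λ)| ≤ 12000 * Λ.card * δ ^ 3 := by
  have hΛ : (0 : ℝ) ≤ Λ.card := Nat.cast_nonneg _
  -- The bound `Z Λ ≥ 1` supplies the lower half; the upper half is the growth bound, valid for all
  -- `δ ≤ 1/6`.
  have hlog : |Real.log (Z Λ)| ≤ Λ.card * (3 * δ) := by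
    rw [abs_of_nonneg (Real.log_nonneg h1)]
    calc Real.log (Z Λ) ≤ Real.log ((1 + 3 * δ) ^ Λ.card) :=
          Real.log_le_log (by linarith)
            ((le_abs_self _).trans (hZ.abs_le_pow hw hδ (by linarith) Λ))
      _ = Λ.card * Real.log (1 + 3 * δ) := Real.log_pow _ _
      _ ≤ _ := by
          refine mul_le_mul_of_nonneg_left ?_ hΛ
          have := Real.log_le_sub_one_of_pos (by linarith : 0 < 1 + 3 * δ)
          linarith
  refine ⟨hlog.trans (by nlinarith), ?_⟩
  rcases le_total δ (1 / 10) with h | h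
  · refine ⟨(hZ.abs_log_sub_firstOrder_le hw hδ h Λ).trans ?_,
      (hZ.abs_log_sub_secondOrder_le hw hδ h Λ).trans ?_⟩
    · have : 0 ≤ Λ.card * δ ^ 2 := by positivity
      linarith
    · have : 0 ≤ Λ.card * δ ^ 3 := by positivity
      linarith
  -- Now `δ ≥ 1/10`, so `δ ≤ 10δ² ≤ 100δ³`. The crude bounds `3δ`, `2δ` and `7δ` per point add up to
  -- `12δ ≤ 1200δ³`, well below the stated constant.
  · have hf := hw.abs_firstOrder_le Λ
    have hs := hw.abs_secondOrder_le hδ (by linarith) Λ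
    have e2 : δ ≤ 10 * δ ^ 2 := by nlinarith
    have e3 : δ ≤ 100 * δ ^ 3 := by nlinarith [mul_nonneg hδ hδ]
    have e2' := mul_le_mul_of_nonneg_left e2 hΛ
    have e3' := mul_le_mul_of_nonneg_left e3 hΛ
    have t1 := abs_sub (Real.log (Z Λ)) (firstOrder w Λ)
    have t2 := abs_sub (Real.log (Z Λ)) (firstOrder w Λ + secondOrder w Λ)
    have t3 := abs_add_le (firstOrder w Λ) (secondOrder w Λ)
    have p2 : 0 ≤ Λ.card * δ ^ 2 := by positivity
    have p3 : 0 ≤ Λ.card * δ ^ 3 := by positivity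
    constructor <;> linarith

end IsPolymerGas

end PolymerGas

/-! ### Graph expansion by the connected component of one vertex. -/

section ConnectedGraphs

variable {K : Type*} [DecidableEq K]

/-- The graph with edge set `g` (loops allowed) is connected and the set of the endpoints of its
edges is `R`. -/
def ConnectedOn (g : Finset (Sym2 K)) (R : Finset K) : Prop :=
  (∀ k, k ∈ R ↔ ∃ e ∈ g, k ∈ e) ∧
    ((SimpleGraph.fromEdgeSet (g : Set (Sym2 K))).induce (R : Set K)).Connected

theorem ConnectedOn.subset_sym2 {K : Type*} {g : Finset (Sym2 K)} {R : Finset K} (h : ConnectedOn g R) :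
    g ⊆ R.sym2 := fun e he => Finset.mem_sym2_iff.2 fun a ha => (h.1 a).2 ⟨e, he, ha⟩

theorem notMem_sym2_of_mem_sym2_sdiff {Λ R : Finset K} {e : Sym2 K} (he : e ∈ (Λ \ R).sym2) :
    e ∉ R.sym2 := by
  induction e using Sym2.ind with
  | h a b =>
    rw [Finset.mk_mem_sym2_iff, Finset.mem_sdiff] at he
    rw [Finset.mk_mem_sym2_iff]
    tauto

variable [Fintype K]

open scoped Classical in
/-- The vertices connected to `k` by the edges of `g`. -/
noncomputable def component (g : Finset (Sym2 K)) (k : K) : Finset K :=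
  Finset.univ.filter fun v => (SimpleGraph.fromEdgeSet (g : Set (Sym2 K))).Reachable k v

theorem mem_component {g : Finset (Sym2 K)} {k v : K} :
    v ∈ component g k ↔ (SimpleGraph.fromEdgeSet (g : Set (Sym2 K))).Reachable k v := by
  simp [component]

theorem self_mem_component (g : Finset (Sym2 K)) (k : K) : k ∈ component g k :=
  mem_component.2 (SimpleGraph.Reachable.refl k)

theorem mem_component_of_edge {g : Finset (Sym2 K)} {k a b : K} {e : Sym2 K} (he : e ∈ g)
    (ha : a ∈ e) (hb : b ∈ e) (hak : a ∈ component g k) : b ∈ component g k := by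
  by_cases hab : a = b
  · exact hab ▸ hak
  · rw [mem_component] at *
    refine hak.trans (SimpleGraph.Adj.reachable ?_)
    rw [SimpleGraph.fromEdgeSet_adj]
    exact ⟨by rwa [← (Sym2.mem_and_mem_iff hab).1 ⟨ha, hb⟩], hab⟩

theorem component_subset_of_closed {g : Finset (Sym2 K)} {k : K} {R : Finset K} (hk : k ∈ R)
    (h : ∀ a b, s(a, b) ∈ g → a ∈ R → b ∈ R) : component g k ⊆ R := by
  intro v hv
  rw [mem_component, SimpleGraph.reachable_iff_reflTransGen] at hv
  induction hv with
  | refl => exact hk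
  | tail _ hbc ih =>
    rw [SimpleGraph.fromEdgeSet_adj] at hbc
    exact h _ _ hbc.1 ih

theorem component_subset {g : Finset (Sym2 K)} {k : K} {Λ : Finset K} (hg : g ⊆ Λ.sym2)
    (hk : k ∈ Λ) : component g k ⊆ Λ :=
  component_subset_of_closed hk fun _ _ h _ => (Finset.mk_mem_sym2_iff.1 (hg h)).2

/-- The edge at `k`, possibly a loop, is essential: an isolated vertex without a loop is connected
but does not lie in the support of its edge set. -/
theorem connectedOn_filter_component {g : Finset (Sym2 K)} {k : K} (hk : ∃ e ∈ g, k ∈ e) :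
    ConnectedOn (g.filter fun e => e ∈ (component g k).sym2) (component g k) := by
  have hind : (SimpleGraph.fromEdgeSet
      ((g.filter fun e => e ∈ (component g k).sym2 : Finset (Sym2 K)) : Set (Sym2 K))).induce
        (component g k : Set K) =
      (SimpleGraph.fromEdgeSet (g : Set (Sym2 K))).induce (component g k : Set K) := by
    ext a b
    have ha := a.2
    have hb := b.2
    rw [Finset.mem_coe] at ha hb
    simp only [SimpleGraph.comap_adj, SimpleGraph.fromEdgeSet_adj, Finset.mem_coe,
      Finset.mem_filter, Finset.mk_mem_sym2_iff, Function.Embedding.subtype_apply, ha, hb, and_true]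
  refine ⟨fun v => ⟨fun hv => ?_, ?_⟩, ?_⟩
  · suffices h : ∃ e ∈ g, v ∈ e by
      obtain ⟨e, he, hve⟩ := h
      refine ⟨e, Finset.mem_filter.2 ⟨he, Finset.mem_sym2_iff.2 fun b hb => ?_⟩, hve⟩
      exact mem_component_of_edge he hve hb hv
    rw [mem_component, SimpleGraph.reachable_iff_reflTransGen] at hv
    cases hv with
    | refl => exact hk
    | tail _ hbc =>
      rw [SimpleGraph.fromEdgeSet_adj] at hbc
      exact ⟨_, hbc.1, Sym2.mem_mk_right _ _⟩
  · rintro ⟨e, he, hv⟩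
    exact Finset.mem_sym2_iff.1 (Finset.mem_filter.1 he).2 v hv
  · rw [hind]
    have hs : (component g k : Set K) =
        ((SimpleGraph.fromEdgeSet (g : Set (Sym2 K))).connectedComponentMk k).supp := by
      ext v
      rw [Finset.mem_coe, mem_component, SimpleGraph.ConnectedComponent.mem_supp_iff,
        SimpleGraph.ConnectedComponent.eq]
      exact SimpleGraph.reachable_comm
    rw [hs]
    exact SimpleGraph.ConnectedComponent.connected_toSimpleGraph _

theorem filter_notMem_subset {g : Finset (Sym2 K)} {k : K} {Λ : Finset K} (hg : g ⊆ Λ.sym2) :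
    (g.filter fun e => e ∉ (component g k).sym2) ⊆ (Λ \ component g k).sym2 := by
  intro e he
  rw [Finset.mem_filter] at he
  refine Finset.mem_sym2_iff.2 fun a ha => ?_
  rw [Finset.mem_sdiff]
  refine ⟨Finset.mem_sym2_iff.1 (hg he.1) a ha, fun hc => he.2 (Finset.mem_sym2_iff.2 fun b hb => ?_)⟩
  exact mem_component_of_edge he.1 ha hb hc

/-- Edges of `g₂` avoid `R`, so no edge leaves `R`, while `g₁` already connects it. This makes
gluing inverse to cutting along the component. -/
theorem component_union {g₁ g₂ : Finset (Sym2 K)} {k : K} {Λ R : Finset K}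
    (h₁ : ConnectedOn g₁ R) (hk : k ∈ R) (h₂ : g₂ ⊆ (Λ \ R).sym2) :
    component (g₁ ∪ g₂) k = R := by
  refine Finset.Subset.antisymm (component_subset_of_closed hk fun a b hab ha => ?_) fun v hv => ?_
  · rcases Finset.mem_union.1 hab with h | h
    · exact (Finset.mk_mem_sym2_iff.1 (h₁.subset_sym2 h)).2
    · exact absurd ha (Finset.mem_sdiff.1 (Finset.mk_mem_sym2_iff.1 (h₂ h)).1).2
  · rw [mem_component]
    have h := h₁.2.preconnected ⟨k, hk⟩ ⟨v, hv⟩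
    have h' := h.map (SimpleGraph.Embedding.induce (R : Set K)).toHom
    refine SimpleGraph.Reachable.mono ?_ h'
    exact SimpleGraph.fromEdgeSet_mono (by simp)

open scoped Classical in
/-- The sum over the connected graphs on `R`, loops allowed, of the products of the edge
weights. -/
noncomputable def connectedSum (f : Sym2 K → ℝ) (R : Finset K) : ℝ :=
  ∑ g ∈ Finset.univ.filter (fun g => ConnectedOn g R), ∏ e ∈ g, f e

/-- Expand over edge sets. Those that do not touch `k` rebuild the product on `Λ.erase k`; any other
splits uniquely into a connected graph on the component `R` of `k` and an arbitrary graph on `Λ \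
R`. -/
theorem prod_one_add_sym2 (f : Sym2 K → ℝ) {Λ : Finset K} {k : K} (hk : k ∈ Λ) :
    ∏ e ∈ Λ.sym2, (1 + f e) = ∏ e ∈ (Λ.erase k).sym2, (1 + f e) +
      ∑ R ∈ Λ.powerset with k ∈ R, connectedSum f R * ∏ e ∈ (Λ \ R).sym2, (1 + f e) := by
  classical
  simp only [Finset.prod_one_add]
  rw [← Finset.sum_filter_add_sum_filter_not Λ.sym2.powerset (fun g => ∀ e ∈ g, k ∉ e)]
  congr 1
  · refine Finset.sum_congr ?_ fun _ _ => rfl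
    ext g
    simp only [Finset.mem_filter, Finset.mem_powerset]
    constructor
    · rintro ⟨h1, h2⟩ e he
      refine Finset.mem_sym2_iff.2 fun a ha => Finset.mem_erase.2 ⟨?_, ?_⟩
      · rintro rfl
        exact h2 e he ha
      · exact Finset.mem_sym2_iff.1 (h1 he) a ha
    · intro h
      refine ⟨fun e he => Finset.sym2_mono (Finset.erase_subset _ _) (h he), fun e he hke => ?_⟩
      exact absurd rfl (Finset.mem_erase.1 (Finset.mem_sym2_iff.1 (h he) k hke)).1
  · have hmaps : ∀ g ∈ Λ.sym2.powerset.filter (fun g => ¬ ∀ e ∈ g, k ∉ e),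
        component g k ∈ Λ.powerset.filter fun R => k ∈ R := by
      intro g hg
      rw [Finset.mem_filter, Finset.mem_powerset] at *
      exact ⟨component_subset hg.1 hk, self_mem_component g k⟩
    rw [← Finset.sum_fiberwise_of_maps_to hmaps]
    refine Finset.sum_congr rfl fun R hR => ?_
    rw [Finset.mem_filter, Finset.mem_powerset] at hR
    rw [connectedSum, Finset.sum_mul_sum, ← Finset.sum_product']
    have hunion : ∀ g₁ g₂ : Finset (Sym2 K), ConnectedOn g₁ R → g₂ ⊆ (Λ \ R).sym2 →
        (g₁ ∪ g₂).filter (fun e => e ∈ R.sym2) = g₁ ∧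
        (g₁ ∪ g₂).filter (fun e => e ∉ R.sym2) = g₂ := by
      intro g₁ g₂ h₁ h₂
      have i₁ : ∀ e ∈ g₁, e ∈ R.sym2 := fun e he => h₁.subset_sym2 he
      have i₂ : ∀ e ∈ g₂, e ∉ R.sym2 := fun e he => notMem_sym2_of_mem_sym2_sdiff (h₂ he)
      rw [Finset.filter_union, Finset.filter_union, Finset.filter_true_of_mem i₁,
        Finset.filter_false_of_mem i₂, Finset.filter_true_of_mem i₂,
        Finset.filter_false_of_mem (s := g₁) fun e he => not_not.2 (i₁ e he)]
      simp
    refine Finset.sum_nbij'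
      (fun g => (g.filter fun e => e ∈ R.sym2, g.filter fun e => e ∉ R.sym2))
      (fun p => p.1 ∪ p.2) ?_ ?_ ?_ ?_ ?_
    · intro g hg
      simp only [Finset.mem_filter, Finset.mem_powerset] at hg
      obtain ⟨⟨hg, hc⟩, rfl⟩ := hg
      push Not at hc
      simp only [Finset.mem_product, Finset.mem_filter, Finset.mem_univ, true_and,
        Finset.mem_powerset]
      exact ⟨connectedOn_filter_component hc, filter_notMem_subset hg⟩
    · rintro ⟨g₁, g₂⟩ hp
      simp only [Finset.mem_product, Finset.mem_filter, Finset.mem_univ, true_and,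
        Finset.mem_powerset] at hp
      simp only [Finset.mem_filter, Finset.mem_powerset]
      refine ⟨⟨Finset.union_subset (hp.1.subset_sym2.trans (Finset.sym2_mono hR.1))
        (hp.2.trans (Finset.sym2_mono Finset.sdiff_subset)), ?_⟩, component_union hp.1 hR.2 hp.2⟩
      obtain ⟨e, he, hke⟩ := (hp.1.1 k).1 hR.2
      exact fun h => h e (Finset.mem_union_left _ he) hke
    · intro g _
      exact Finset.filter_union_filter_not_eq _ _
    · rintro ⟨g₁, g₂⟩ hp
      simp only [Finset.mem_product, Finset.mem_filter, Finset.mem_univ, true_and,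
        Finset.mem_powerset] at hp
      obtain ⟨h1, h2⟩ := hunion g₁ g₂ hp.1 hp.2
      simp only [h1, h2]
    · intro g _
      exact (Finset.prod_filter_mul_prod_filter_not g (fun e => e ∈ R.sym2) f).symm

end ConnectedGraphs

/-! ### Conditional measure: uniformity, independence of cells, exchangeability within cells. -/

namespace IsingModel

variable (S : IsingModel)

theorem exists_sum_eq_of_mem_coarseSpins {q : ℕ} {a : ℤ} (ha : a ∈ coarseSpins q) :
    ∃ s : Fin q → ℤˣ, ∑ i, (s i : ℤ) = a := by
  obtain ⟨b, hb, rfl⟩ := Finset.mem_image.1 ha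
  rw [Finset.mem_range, Nat.lt_succ_iff] at hb
  refine ⟨fun i => if (i : ℕ) < b then 1 else -1, ?_⟩
  have h : ∀ i : Fin q, (((if (i : ℕ) < b then 1 else -1 : ℤˣ) : ℤˣ) : ℤ) =
      2 * (if (i : ℕ) < b then 1 else 0) - 1 := by
    intro i
    split_ifs <;> simp
  rw [Finset.sum_congr rfl fun i _ => h i, Finset.sum_sub_distrib, ← Finset.mul_sum,
    Finset.sum_boole]
  have hc : (Finset.univ.filter fun i : Fin q => (i : ℕ) < b).card = b := by
    rw [Fin.card_filter_val_lt]
    exact min_eq_right hb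
  rw [hc]
  simp

theorem block_surjective : Function.Surjective S.block := by
  intro η
  choose s hs using fun k => exists_sum_eq_of_mem_coarseSpins (η k).2
  exact ⟨fun x => s x.1 x.2, funext fun k => Subtype.ext (hs k)⟩

/-- The spin configurations with block spins `η`. -/
def fiber (η : S.CoarseConfig) : Finset S.SpinConfig := Finset.univ.filter fun σ => S.block σ = η

theorem mem_fiber {η : S.CoarseConfig} {σ : S.SpinConfig} : σ ∈ S.fiber η ↔ S.block σ = η := by
  simp [fiber]

theorem fiber_nonempty (η : S.CoarseConfig) : (S.fiber η).Nonempty := by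
  obtain ⟨σ, hσ⟩ := S.block_surjective η
  exact ⟨σ, S.mem_fiber.2 hσ⟩

instance : MeasurableSingletonClass ℤˣ :=
  ⟨fun u => ⟨{(u : ℤ)}, measurableSet_singleton _, by ext v; simp [Units.ext_iff]⟩⟩

instance : IsProbabilityMeasure (uniformOn (Set.univ : Set ℤˣ)) :=
  isProbabilityMeasure_uniformOn Set.finite_univ Set.univ_nonempty

instance : IsProbabilityMeasure S.prior := by
  unfold prior
  infer_instance

theorem prior_singleton (σ τ : S.SpinConfig) : S.prior {σ} = S.prior {τ} := by
  simp only [prior, Measure.pi_singleton, uniformOn_univ, Measure.count_singleton]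

theorem prior_singleton_ne_zero (σ : S.SpinConfig) : S.prior {σ} ≠ 0 := by
  intro h
  have h1 : S.prior Set.univ = 0 := by
    rw [← Set.biUnion_of_singleton Set.univ]
    exact (measure_biUnion_null_iff (Set.to_countable _)).2 fun τ _ => by
      rw [S.prior_singleton τ σ, h]
  rw [measure_univ] at h1
  exact one_ne_zero h1

theorem prior_preimage_ne_zero (η : S.CoarseConfig) : S.prior (S.block ⁻¹' {η}) ≠ 0 := by
  obtain ⟨σ, hσ⟩ := S.block_surjective η
  exact fun h => S.prior_singleton_ne_zero σ
    (measure_mono_null (Set.singleton_subset_iff.2 (by simpa using hσ)) h)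

instance (η : S.CoarseConfig) : IsProbabilityMeasure (S.condPrior η) :=
  cond_isProbabilityMeasure (S.prior_preimage_ne_zero η)

/-- All configurations have equal prior mass, so the conditional law is uniform on the fiber and its
expectation is a finite average. -/
theorem condExpect_eq (η : S.CoarseConfig) (g : S.SpinConfig → ℝ) :
    S.condExpect η g = ((S.fiber η).card : ℝ)⁻¹ * ∑ σ ∈ S.fiber η, g σ := by
  obtain ⟨σ₀, hσ₀⟩ := S.fiber_nonempty η
  set a : ℝ := ((S.prior (S.block ⁻¹' {η}))⁻¹ * S.prior {σ₀}).toReal with ha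
  have h1 : ∀ σ, (S.condPrior η).real {σ} = if σ ∈ S.fiber η then a else 0 := by
    intro σ
    rw [condPrior, measureReal_def, cond_apply (Set.toFinite _).measurableSet]
    split_ifs with h
    · rw [Set.inter_eq_right.2 (Set.singleton_subset_iff.2 (by simpa using S.mem_fiber.1 h)), ha,
        S.prior_singleton σ σ₀]
    · rw [Set.inter_singleton_eq_empty.2 fun h' => h (S.mem_fiber.2 (by simpa using h'))]
      simp
  have h2 : ∀ g : S.SpinConfig → ℝ, S.condExpect η g = a * ∑ σ ∈ S.fiber η, g σ := by
    intro g
    rw [condExpect, integral_fintype (Integrable.of_finite)]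
    simp only [h1, smul_eq_mul, ite_mul, zero_mul]
    rw [← Finset.sum_filter, Finset.filter_mem_eq_inter, Finset.univ_inter, Finset.mul_sum]
  have h3 : a * (S.fiber η).card = 1 := by
    have := h2 fun _ => 1
    rw [condExpect, integral_const, probReal_univ] at this
    simpa using this.symm
  rw [h2, eq_inv_of_mul_eq_one_left h3]

theorem card_fiber_ne_zero (η : S.CoarseConfig) : ((S.fiber η).card : ℝ) ≠ 0 :=
  Nat.cast_ne_zero.2 (Finset.card_pos.2 (S.fiber_nonempty η)).ne'

theorem condExpect_congr {η : S.CoarseConfig} {g h : S.SpinConfig → ℝ}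
    (H : ∀ σ, S.block σ = η → g σ = h σ) : S.condExpect η g = S.condExpect η h := by
  rw [condExpect_eq, condExpect_eq, Finset.sum_congr rfl fun σ hσ => H σ (S.mem_fiber.1 hσ)]

theorem condExpect_const (η : S.CoarseConfig) (c : ℝ) : S.condExpect η (fun _ => c) = c := by
  simp [condExpect]

theorem condExpect_add (η : S.CoarseConfig) (g h : S.SpinConfig → ℝ) :
    S.condExpect η (fun σ => g σ + h σ) = S.condExpect η g + S.condExpect η h := by
  simp only [condExpect_eq, Finset.sum_add_distrib, mul_add]

theorem condExpect_const_mul (η : S.CoarseConfig) (c : ℝ) (g : S.SpinConfig → ℝ) :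
    S.condExpect η (fun σ => c * g σ) = c * S.condExpect η g := by
  simp only [condExpect_eq, ← Finset.mul_sum, mul_left_comm]

theorem condExpect_sum {ι : Type*} (η : S.CoarseConfig) (s : Finset ι)
    (g : ι → S.SpinConfig → ℝ) :
    S.condExpect η (fun σ => ∑ i ∈ s, g i σ) = ∑ i ∈ s, S.condExpect η (g i) := by
  simp only [condExpect_eq, ← Finset.mul_sum]
  rw [Finset.sum_comm]

theorem condExpect_mono {η : S.CoarseConfig} {g h : S.SpinConfig → ℝ}
    (H : ∀ σ, g σ ≤ h σ) : S.condExpect η g ≤ S.condExpect η h := by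
  rw [condExpect_eq, condExpect_eq]
  exact mul_le_mul_of_nonneg_left (Finset.sum_le_sum fun σ _ => H σ) (by positivity)

/-- `g` depends only on the spins in the cells of `A`. -/
def LocalOn (A : Finset S.Cell) (g : S.SpinConfig → ℝ) : Prop :=
  ∀ σ τ : S.SpinConfig, (∀ x : S.Site, x.1 ∈ A → σ x = τ x) → g σ = g τ

/-- The configuration that equals `σ` on the cells in `A` and `τ` on the others. -/
def mix (A : Finset S.Cell) (σ τ : S.SpinConfig) : S.SpinConfig :=
  fun x => if x.1 ∈ A then σ x else τ x

theorem mix_mem_fiber {η : S.CoarseConfig} {A : Finset S.Cell} {σ τ : S.SpinConfig}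
    (hσ : σ ∈ S.fiber η) (hτ : τ ∈ S.fiber η) : S.mix A σ τ ∈ S.fiber η := by
  rw [mem_fiber] at *
  funext k
  by_cases hk : k ∈ A
  · rw [← hσ]
    simp [block, mix, hk]
  · rw [← hτ]
    simp [block, mix, hk]

/-- Exchanging the spins outside `A` between two configurations is an involution of the squared
fiber, because block spins are computed cell by cell. It turns `g σ * h τ` into `g σ * h σ`, which
is independence in counting form. -/
theorem condExpect_mul {η : S.CoarseConfig} {A B : Finset S.Cell} {g h : S.SpinConfig → ℝ}
    (hg : S.LocalOn A g) (hh : S.LocalOn B h) (hAB : Disjoint A B) :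
    S.condExpect η (fun σ => g σ * h σ) = S.condExpect η g * S.condExpect η h := by
  have key : (∑ σ ∈ S.fiber η, g σ) * ∑ τ ∈ S.fiber η, h τ =
      (S.fiber η).card * ∑ σ ∈ S.fiber η, g σ * h σ := by
    have e : ((S.fiber η).card : ℝ) * ∑ σ ∈ S.fiber η, g σ * h σ =
        ∑ p ∈ S.fiber η ×ˢ S.fiber η, g p.1 * h p.1 := by
      rw [Finset.sum_product]
      simp [Finset.mul_sum]
    rw [e, Finset.sum_mul_sum, ← Finset.sum_product']
    refine Finset.sum_nbij' (fun p => (S.mix A p.1 p.2, S.mix A p.2 p.1))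
      (fun p => (S.mix A p.1 p.2, S.mix A p.2 p.1)) ?_ ?_ ?_ ?_ ?_
    · intro p hp
      rw [Finset.mem_product] at *
      exact ⟨S.mix_mem_fiber hp.1 hp.2, S.mix_mem_fiber hp.2 hp.1⟩
    · intro p hp
      rw [Finset.mem_product] at *
      exact ⟨S.mix_mem_fiber hp.1 hp.2, S.mix_mem_fiber hp.2 hp.1⟩
    · rintro ⟨σ, τ⟩ -
      ext x <;> by_cases hx : x.1 ∈ A <;> simp [mix, hx]
    · rintro ⟨σ, τ⟩ -
      ext x <;> by_cases hx : x.1 ∈ A <;> simp [mix, hx]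
    · rintro ⟨σ, τ⟩ -
      congr 1
      · exact hg _ _ fun x hx => by simp [mix, hx]
      · exact hh _ _ fun x hx => by simp [mix, Finset.disjoint_right.1 hAB hx]
  have hc := S.card_fiber_ne_zero η
  rw [condExpect_eq, condExpect_eq, condExpect_eq]
  field_simp
  linarith

theorem condExpect_comp_perm (η : S.CoarseConfig) (π : Equiv.Perm S.Site)
    (hπ : ∀ σ : S.SpinConfig, S.block (fun x => σ (π x)) = S.block σ) (g : S.SpinConfig → ℝ) :
    S.condExpect η (fun σ => g (fun x => σ (π x))) = S.condExpect η g := by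
  rw [condExpect_eq, condExpect_eq]
  congr 1
  refine Finset.sum_nbij' (fun σ x => σ (π x)) (fun σ x => σ (π.symm x)) ?_ ?_ ?_ ?_ ?_
  · intro σ hσ
    rw [mem_fiber] at *
    rw [hπ, hσ]
  · intro σ hσ
    rw [mem_fiber] at *
    rw [← hπ]
    simpa using hσ
  · intro σ _
    simp
  · intro σ _
    simp
  · intro σ _
    rfl

theorem block_comp_swap {x y : S.Site} (hxy : x.1 = y.1) (σ : S.SpinConfig) :
    S.block (fun z => σ (Equiv.swap x y z)) = S.block σ := by
  obtain ⟨k, i⟩ := x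
  obtain ⟨l, j⟩ := y
  obtain rfl : k = l := hxy
  funext p
  refine Subtype.ext ?_
  simp only [block]
  by_cases hp : p = k
  · subst hp
    rw [← Equiv.sum_comp (Equiv.swap i j)]
    refine Finset.sum_congr rfl fun a _ => ?_
    congr 2
    have hinj : Function.Injective fun a : Fin S.q => (p, a) := fun a b h => (Prod.mk.inj h).2
    have : Equiv.swap (p, i) (p, j) (p, Equiv.swap i j a) =
        (p, Equiv.swap i j (Equiv.swap i j a)) := by
      simp only [Equiv.swap_apply_def]
      split_ifs <;> simp_all
    rw [this, Equiv.swap_apply_self]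
  · refine Finset.sum_congr rfl fun a _ => ?_
    rw [Equiv.swap_apply_of_ne_of_ne] <;> simp [hp]

/-- The correlation of two spins given the block spins. -/
noncomputable def corr (η : S.CoarseConfig) (x y : S.Site) : ℝ :=
  S.condExpect η fun σ => S.spin σ x * S.spin σ y

theorem corr_comm (η : S.CoarseConfig) (x y : S.Site) : S.corr η x y = S.corr η y x := by
  simp only [corr, mul_comm]

theorem corr_move {η : S.CoarseConfig} {x x' y : S.Site} (hx : x.1 = x'.1) (hxy : x ≠ y)
    (hxy' : x' ≠ y) : S.corr η x y = S.corr η x' y := by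
  rw [corr, ← S.condExpect_comp_perm η (Equiv.swap x x') (S.block_comp_swap hx)]
  simp only [spin, Equiv.swap_apply_left, Equiv.swap_apply_of_ne_of_ne hxy.symm hxy'.symm]
  rfl

/-- Sites within a cell are exchangeable, so one site is moved at a time. The case distinction
avoids an intermediate pair with coinciding sites. -/
theorem corr_eq {η : S.CoarseConfig} {x x' y y' : S.Site} (hx : x.1 = x'.1) (hy : y.1 = y'.1)
    (hxy : x ≠ y) (hxy' : x' ≠ y') : S.corr η x y = S.corr η x' y' := by
  by_cases h : x' = y
  · subst h
    by_cases h' : y' = x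
    · subst h'
      exact S.corr_comm η _ _
    · rw [corr_comm, S.corr_move hy hxy.symm (Ne.symm (Ne.symm h')), corr_comm,
        S.corr_move hx (Ne.symm h') hxy']
  · rw [S.corr_move hx hxy h, corr_comm, S.corr_move hy (Ne.symm h) hxy'.symm, corr_comm]

theorem sum_J_sub_Jbar (k l : S.Cell) :
    ∑ i : Fin S.q, ∑ j ∈ Finset.univ.filter (fun j : Fin S.q => (l, j) ≠ (k, i)),
      (S.J (k, i) (l, j) - S.Jbar k l) = 0 := by
  have hq : (S.q : ℝ) ≠ 0 := Nat.cast_ne_zero.2 S.q_pos.ne'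
  by_cases hkl : k = l
  · subst hkl
    have hf : ∀ i : Fin S.q, (Finset.univ.filter fun j : Fin S.q => (k, j) ≠ (k, i)) =
        Finset.univ.filter fun j => j ≠ i := by
      intro i
      ext j
      simp
    simp only [hf, Jbar, if_true, Finset.sum_sub_distrib, Finset.sum_const]
    have hc : ∀ i : Fin S.q, (Finset.univ.filter fun j : Fin S.q => j ≠ i).card = S.q - 1 := by
      intro i
      rw [Finset.filter_ne', Finset.card_erase_of_mem (Finset.mem_univ _)]
      simp
    simp only [hc, nsmul_eq_mul, Nat.cast_sub S.q_pos, Nat.cast_one]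
    -- For `q = 1` the normalisation `1 / (q * (q - 1))` is division by zero, but there are no pairs
    -- to sum over.
    by_cases h1 : S.q = 1
    · have : ∀ i : Fin S.q, (Finset.univ.filter fun j : Fin S.q => j ≠ i) = ∅ := by
        intro i
        rw [← Finset.card_eq_zero, hc, h1]
      simp [this]
    · have : (S.q : ℝ) - 1 ≠ 0 := sub_ne_zero.2 (by exact_mod_cast h1)
      rw [Finset.sum_const, Finset.card_univ, Fintype.card_fin, nsmul_eq_mul]
      field_simp
      ring
  · have hf : ∀ i : Fin S.q, (Finset.univ.filter fun j : Fin S.q => (l, j) ≠ (k, i)) =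
        Finset.univ := by
      intro i
      ext j
      simp [Ne.symm hkl]
    simp only [hf, Jbar, if_neg hkl, Finset.sum_sub_distrib, Finset.sum_const, Finset.card_univ,
      Fintype.card_fin, nsmul_eq_mul]
    field_simp
    ring

/-- The correlation of distinct sites is one constant per pair of cells, and it multiplies the sum
of `J - Jbar`, which vanishes by the choice of `Jbar`. -/
theorem condExpect_Delta (η : S.CoarseConfig) (k l : S.Cell) :
    S.condExpect η (S.Delta k l) = 0 := by
  obtain ⟨c, hc⟩ : ∃ c, ∀ i j, (l, j) ≠ (k, i) → S.corr η (k, i) (l, j) = c := by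
    by_cases h : ∃ i j : Fin S.q, (l, j) ≠ (k, i)
    · obtain ⟨i₀, j₀, h₀⟩ := h
      exact ⟨S.corr η (k, i₀) (l, j₀), fun i j hij => S.corr_eq rfl rfl hij.symm h₀.symm⟩
    · exact ⟨0, fun i j hij => absurd ⟨i, j, hij⟩ h⟩
  have h1 : S.condExpect η (S.Delta k l) = -(1 / 2) * ∑ i : Fin S.q,
      ∑ j ∈ Finset.univ.filter (fun j : Fin S.q => (l, j) ≠ (k, i)),
        (S.J (k, i) (l, j) - S.Jbar k l) * (2 - if k = l then 1 else 0) * S.corr η (k, i) (l, j) := by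
    unfold Delta
    rw [condExpect_const_mul, condExpect_sum]
    congr 1
    refine Finset.sum_congr rfl fun i _ => ?_
    rw [condExpect_sum]
    refine Finset.sum_congr rfl fun j _ => ?_
    rw [corr, ← condExpect_const_mul]
    congr 1
    funext σ
    ring
  have h2 : ∑ i : Fin S.q, ∑ j ∈ Finset.univ.filter (fun j : Fin S.q => (l, j) ≠ (k, i)),
        (S.J (k, i) (l, j) - S.Jbar k l) * (2 - if k = l then 1 else 0) * S.corr η (k, i) (l, j) =
      (∑ i : Fin S.q, ∑ j ∈ Finset.univ.filter (fun j : Fin S.q => (l, j) ≠ (k, i)),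
        (S.J (k, i) (l, j) - S.Jbar k l)) * ((2 - if k = l then 1 else 0) * c) := by
    rw [Finset.sum_mul]
    refine Finset.sum_congr rfl fun i _ => ?_
    rw [Finset.sum_mul]
    refine Finset.sum_congr rfl fun j hj => ?_
    rw [hc i j (Finset.mem_filter.1 hj).2]
    ring
  rw [h1, h2, sum_J_sub_Jbar]
  ring

end IsingModel

/-! ### Connected sums on at most three vertices. -/

section FiniteSums

variable {K : Type*} [DecidableEq K]

theorem prod_sym2_insert {k : K} {Λ : Finset K} (hk : k ∉ Λ) (F : Sym2 K → ℝ) :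
    ∏ e ∈ (insert k Λ).sym2, F e = F s(k, k) * (∏ l ∈ Λ, F s(k, l)) * ∏ e ∈ Λ.sym2, F e := by
  rw [Finset.sym2_insert, Finset.prod_union, Finset.prod_image, Finset.prod_insert hk]
  · intro a _ b _ hab
    exact Sym2.congr_right.1 hab
  · rw [Finset.disjoint_left]
    intro e he he'
    obtain ⟨a, -, rfl⟩ := Finset.mem_image.1 he
    exact hk (Finset.mk_mem_sym2_iff.1 he').1

theorem prod_sym2_singleton {K : Type*} (k : K) (F : Sym2 K → ℝ) :
    ∏ e ∈ ({k} : Finset K).sym2, F e = F s(k, k) := Finset.prod_singleton _ _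

variable [Fintype K]

/-- Here, and for two and three vertices below, the component expansion with `Λ = R` is solved for
its top term, which avoids enumerating connected edge sets. -/
theorem connectedSum_singleton (f : Sym2 K → ℝ) (k : K) : connectedSum f {k} = f s(k, k) := by
  have h := prod_one_add_sym2 f (Finset.mem_singleton_self k)
  have hP : (({k} : Finset K).powerset.filter fun R => k ∈ R) = {{k}} := by
    ext R
    simp only [Finset.mem_filter, Finset.mem_powerset, Finset.mem_singleton,
      Finset.subset_singleton_iff]
    constructor
    · rintro ⟨rfl | rfl, h⟩
      · simp at h
      · rfl
    · rintro rfl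
      simp
  rw [hP, Finset.sum_singleton] at h
  simp at h
  exact h.symm

theorem connectedSum_pair (f : Sym2 K → ℝ) {k l : K} (hkl : k ≠ l) :
    connectedSum f {k, l} = f s(k, l) * (1 + f s(k, k)) * (1 + f s(l, l)) := by
  have hk : k ∉ ({l} : Finset K) := by simpa using hkl
  have h := prod_one_add_sym2 f (Finset.mem_insert_self k {l})
  have hP : (({k, l} : Finset K).powerset.filter fun R => k ∈ R) = {{k}, {k, l}} := by
    ext R
    simp only [Finset.mem_filter, Finset.mem_powerset, Finset.mem_singleton, Finset.mem_insert]
    grind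
  have hne : ({k} : Finset K) ≠ {k, l} := fun h => by
    have := Finset.ext_iff.1 h l
    grind
  have e1 : ({k, l} : Finset K) \ {k} = {l} := by grind
  rw [hP, Finset.sum_pair hne, connectedSum_singleton, prod_sym2_insert hk, Finset.erase_insert hk,
    e1, sdiff_self, prod_sym2_singleton] at h
  simp at h
  linarith

theorem connectedSum_triple (f : Sym2 K → ℝ) {k l p : K} (hkl : k ≠ l) (hkp : k ≠ p)
    (hlp : l ≠ p) :
    connectedSum f {k, l, p} =
      (f s(k, l) * f s(l, p) + f s(k, l) * f s(k, p) + f s(k, p) * f s(l, p)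
        + f s(k, l) * f s(l, p) * f s(k, p)) *
      ((1 + f s(k, k)) * (1 + f s(l, l)) * (1 + f s(p, p))) := by
  have hk : k ∉ ({l, p} : Finset K) := by simp [hkl, hkp]
  have hl : l ∉ ({p} : Finset K) := by simpa using hlp
  have h := prod_one_add_sym2 f (Finset.mem_insert_self k {l, p})
  have hP : (({k, l, p} : Finset K).powerset.filter fun R => k ∈ R) =
      {{k}, {k, l}, {k, p}, {k, l, p}} := by
    ext R
    simp only [Finset.mem_filter, Finset.mem_powerset, Finset.mem_singleton, Finset.mem_insert]
    grind
  have n1 : ({k} : Finset K) ∉ ({{k, l}, {k, p}, {k, l, p}} : Finset (Finset K)) := by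
    simp only [Finset.mem_insert, Finset.mem_singleton, Finset.ext_iff]
    rintro (h | h | h)
    · have := h l
      grind
    · have := h p
      grind
    · have := h l
      grind
  have n2 : ({k, l} : Finset K) ∉ ({{k, p}, {k, l, p}} : Finset (Finset K)) := by
    simp only [Finset.mem_insert, Finset.mem_singleton, Finset.ext_iff]
    rintro (h | h)
    · have := h l
      grind
    · have := h p
      grind
  have n3 : ({k, p} : Finset K) ≠ {k, l, p} := fun h => by
    have := Finset.ext_iff.1 h l
    grind
  have e1 : ({k, l, p} : Finset K) \ {k} = {l, p} := by grind
  have e2 : ({k, l, p} : Finset K) \ {k, l} = {p} := by grind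
  have e3 : ({k, l, p} : Finset K) \ {k, p} = {l} := by grind
  rw [hP, Finset.sum_insert n1, Finset.sum_insert n2, Finset.sum_pair n3, connectedSum_singleton,
    connectedSum_pair f hkl, connectedSum_pair f hkp, prod_sym2_insert hk, Finset.erase_insert hk,
    e1, e2, e3, sdiff_self, prod_sym2_insert hl, Finset.prod_pair hlp,
    prod_sym2_singleton, prod_sym2_singleton] at h
  simp at h
  linear_combination -h

theorem sum_card_one {K : Type*} [Fintype K] (g : Finset K → ℝ) :
    ∑ R : Finset K with R.card = 1, g R = ∑ k, g {k} := by
  symm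
  refine Finset.sum_nbij (fun k => {k}) ?_ ?_ ?_ ?_
  · intro k _
    simp
  · intro a _ b _ h
    exact Finset.singleton_injective h
  · intro R hR
    obtain ⟨k, rfl⟩ := Finset.card_eq_one.1 (Finset.mem_filter.1 hR).2
    exact ⟨k, by simp, rfl⟩
  · intro k _
    rfl

theorem sum_card_two_mem (g : Finset K → ℝ) (k : K) :
    ∑ R : Finset K with R.card = 2 ∧ k ∈ R, g R = ∑ l with l ≠ k, g {k, l} := by
  symm
  refine Finset.sum_nbij (fun l => {k, l}) ?_ ?_ ?_ ?_
  · intro l hl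
    have := (Finset.mem_filter.1 hl).2
    simp [Finset.card_pair this.symm]
  · intro a ha b hb h
    have ha := (Finset.mem_filter.1 ha).2
    have hb := (Finset.mem_filter.1 hb).2
    have : a ∈ ({k, b} : Finset K) := by
      rw [← (show ({k, a} : Finset K) = {k, b} from h)]
      simp
    simpa [ha] using this
  · intro R hR
    have hR := (Finset.mem_filter.1 hR).2
    obtain ⟨l, hl, rfl⟩ := exists_eq_pair hR.2 hR.1
    exact ⟨l, by simp [hl], rfl⟩
  · intro k _
    rfl

end FiniteSums

/-! ### Cluster sums as ordered sums over cells. -/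

section OrderedSums

variable {K : Type*} [LinearOrder K] [Fintype K]

theorem sum_eq_diag_add_lt_add_gt (F : K → K → ℝ) (k : K) :
    ∑ l, F k l = F k k + ∑ l with k < l, F k l + ∑ l with l < k, F k l := by
  rw [← Finset.sum_filter_add_sum_filter_not Finset.univ (fun l => k < l),
    ← Finset.sum_filter_add_sum_filter_not (Finset.univ.filter fun l => ¬ k < l) (fun l => l < k),
    Finset.filter_filter, Finset.filter_filter]
  have e1 : (Finset.univ.filter fun l => ¬ k < l ∧ l < k) = Finset.univ.filter fun l => l < k := by
    ext l
    simp only [Finset.mem_filter, Finset.mem_univ, true_and]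
    exact ⟨fun h => h.2, fun h => ⟨h.not_gt, h⟩⟩
  have e2 : (Finset.univ.filter fun l => ¬ k < l ∧ ¬ l < k) = {k} := by
    ext l
    simp only [Finset.mem_filter, Finset.mem_univ, true_and, Finset.mem_singleton, not_lt]
    exact ⟨fun h => le_antisymm h.1 h.2, fun h => by simp [h]⟩
  rw [e1, e2, Finset.sum_singleton]
  ring

theorem sum_lt_comm (F : K → K → ℝ) :
    ∑ k, ∑ l with l < k, F k l = ∑ k, ∑ l with k < l, F l k :=
  Finset.sum_comm' (by simp)

theorem sum_sum_eq (F : K → K → ℝ) :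
    ∑ k, ∑ l, F k l = ∑ k, F k k + ∑ k, ∑ l with k < l, (F k l + F l k) := by
  rw [Finset.sum_congr rfl fun k _ => sum_eq_diag_add_lt_add_gt F k]
  simp only [Finset.sum_add_distrib]
  rw [sum_lt_comm]
  ring

theorem sum_sum_ne_eq (F : K → K → ℝ) :
    ∑ k, ∑ l with l ≠ k, F k l = ∑ k, ∑ l with k < l, (F k l + F l k) := by
  have h : ∑ k, ∑ l with l ≠ k, F k l = ∑ k, ∑ l, if l ≠ k then F k l else 0 := by
    simp only [Finset.sum_filter]
  rw [h, sum_sum_eq fun k l => if l ≠ k then F k l else 0]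
  simp only [ne_eq, not_true, if_false, Finset.sum_const_zero, zero_add]
  refine Finset.sum_congr rfl fun k _ => Finset.sum_congr rfl fun l hl => ?_
  have hl := (Finset.mem_filter.1 hl).2
  rw [if_pos hl.ne', if_pos hl.ne]

theorem sum_sym2_eq (F : Sym2 K → ℝ) :
    ∑ e, F e = ∑ k, F s(k, k) + ∑ k, ∑ l with k < l, F s(k, l) := by
  have h1 : ∑ e, F e = ∑ x : K × K with x.1 ≤ x.2, F s(x.1, x.2) := by
    rw [← Finset.sum_subtype_eq_sum_filter]
    refine (Finset.sum_equiv Sym2.sortEquiv.symm ?_ ?_).symm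
    all_goals aesop
  rw [h1, Finset.sum_filter, Fintype.sum_prod_type, ← Finset.sum_add_distrib]
  refine Finset.sum_congr rfl fun k _ => ?_
  rw [sum_eq_diag_add_lt_add_gt (fun k l => if k ≤ l then F s(k, l) else 0), if_pos le_rfl,
    Finset.sum_eq_zero (s := Finset.univ.filter fun l => l < k), add_zero]
  · congr 1
    exact Finset.sum_congr rfl fun l hl => if_pos (Finset.mem_filter.1 hl).2.le
  · intro l hl
    exact if_neg (not_le.2 (Finset.mem_filter.1 hl).2)

theorem sum_card_two (g : Finset K → ℝ) :
    ∑ R : Finset K with R.card = 2, g R = ∑ k, ∑ l with k < l, g {k, l} := by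
  symm
  rw [Finset.sum_sigma']
  refine Finset.sum_nbij (fun x => {x.1, x.2}) ?_ ?_ ?_ ?_
  · rintro ⟨k, l⟩ h
    simp only [Finset.mem_sigma, Finset.mem_filter, Finset.mem_univ, true_and] at h
    simp [Finset.card_pair h.ne]
  · rintro ⟨a, b⟩ h ⟨c, d⟩ h' heq
    simp only [Finset.coe_sigma, Set.mem_sigma_iff, Finset.coe_filter, Finset.mem_univ, true_and,
      Set.mem_ofPred_eq, Finset.coe_univ, Set.mem_univ] at h h'
    have heq : ({a, b} : Finset K) = {c, d} := heq
    have ha := Finset.ext_iff.1 heq a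
    have hb := Finset.ext_iff.1 heq b
    have hc := Finset.ext_iff.1 heq c
    have hd := Finset.ext_iff.1 heq d
    simp only [Finset.mem_insert, Finset.mem_singleton] at ha hb hc hd
    have : a = c ∧ b = d := by grind
    rw [this.1, this.2]
  · intro R hR
    obtain ⟨a, b, hab, rfl⟩ := Finset.card_eq_two.1 (Finset.mem_filter.1 hR).2
    rcases lt_or_gt_of_ne hab with h | h
    · exact ⟨⟨a, b⟩, by simp [h], rfl⟩
    · exact ⟨⟨b, a⟩, by simp [h], Finset.pair_comm _ _⟩
  · intro k _
    rfl

theorem sum_card_three (g : Finset K → ℝ) :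
    ∑ R : Finset K with R.card = 3, g R =
      ∑ k, ∑ l with k < l, ∑ p with l < p, g {k, l, p} := by
  symm
  simp only [Finset.sum_sigma']
  refine Finset.sum_nbij (fun x => {x.1, x.2.1, x.2.2}) ?_ ?_ ?_ ?_
  · rintro ⟨k, l, p⟩ h
    simp only [Finset.mem_sigma, Finset.mem_filter, Finset.mem_univ, true_and] at h
    simp [Finset.card_eq_three]
    exact ⟨k, l, h.1.ne, p, (h.1.trans h.2).ne, h.2.ne, rfl⟩
  · rintro ⟨a, b, c⟩ h ⟨a', b', c'⟩ h' heq
    simp only [Finset.coe_sigma, Set.mem_sigma_iff, Finset.coe_filter, Finset.mem_univ, true_and,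
      Set.mem_ofPred_eq, Finset.coe_univ, Set.mem_univ] at h h'
    have heq : ({a, b, c} : Finset K) = {a', b', c'} := heq
    have ha := Finset.ext_iff.1 heq a
    have hb := Finset.ext_iff.1 heq b
    have hc := Finset.ext_iff.1 heq c
    have ha' := Finset.ext_iff.1 heq a'
    have hb' := Finset.ext_iff.1 heq b'
    have hc' := Finset.ext_iff.1 heq c'
    simp only [Finset.mem_insert, Finset.mem_singleton] at ha hb hc ha' hb' hc'
    have : a = a' ∧ b = b' ∧ c = c' := by grind
    rw [this.1, this.2.1, this.2.2]
  · intro R hR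
    have hc : R.card = 3 := (Finset.mem_filter.1 hR).2
    refine ⟨⟨R.orderEmbOfFin hc 0, R.orderEmbOfFin hc 1, R.orderEmbOfFin hc 2⟩, ?_, ?_⟩
    · simp
    · have h := Finset.image_orderEmbOfFin_univ R hc
      simpa [Fin.univ_succ] using h
  · intro k _
    rfl

theorem firstOrder_univ (w : Finset K → ℝ) :
    firstOrder w Finset.univ = ∑ k, w {k} + ∑ k, ∑ l with k < l, w {k, l} := by
  rw [← sum_card_one w, ← sum_card_two w, ← Finset.sum_union]
  · refine Finset.sum_congr ?_ fun _ _ => rfl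
    ext R
    simp [smallPolymers]
  · rw [Finset.disjoint_filter]
    rintro R - h1 h2
    omega

theorem smallSum_univ (w : Finset K → ℝ) (k : K) :
    smallSum w Finset.univ k = w {k} + ∑ l with l ≠ k, w {k, l} := by
  rw [← sum_card_two_mem w, ← Finset.sum_singleton (fun R => w R) {k}, ← Finset.sum_union]
  · refine Finset.sum_congr ?_ fun _ _ => rfl
    ext R
    simp only [smallPolymers, Finset.mem_filter, Finset.mem_powerset, Finset.subset_univ, true_and,
      Finset.mem_union, Finset.mem_singleton, Finset.mem_univ]
    constructor
    · rintro ⟨h | h, hk⟩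
      · obtain ⟨l, rfl⟩ := Finset.card_eq_one.1 h
        exact Or.inl (by rw [Finset.mem_singleton.1 hk])
      · exact Or.inr ⟨h, hk⟩
    · rintro (rfl | h)
      · simp
      · exact ⟨Or.inr h.1, h.2⟩
  · rw [Finset.disjoint_left]
    intro R h1 h2
    rw [Finset.mem_singleton] at h1
    subst h1
    simp at h2

theorem meetSum_univ_singleton (w : Finset K → ℝ) (k : K) :
    meetSum w Finset.univ {k} = smallSum w Finset.univ k := by
  rw [meetSum, smallSum, Finset.sum_filter]
  refine Finset.sum_congr rfl fun R _ => ?_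
  by_cases h : k ∈ R <;> simp [h]

/-- Inclusion-exclusion: the only polymer of size at most two containing both `k` and `l` is the
pair itself. -/
theorem meetSum_univ_pair (w : Finset K → ℝ) {k l : K} (hkl : k ≠ l) :
    meetSum w Finset.univ {k, l} =
      smallSum w Finset.univ k + smallSum w Finset.univ l - w {k, l} := by
  have h : w {k, l} = ∑ R ∈ smallPolymers Finset.univ with k ∈ R ∧ l ∈ R, w R := by
    rw [← Finset.sum_singleton (fun R => w R) {k, l}]
    refine Finset.sum_congr ?_ fun _ _ => rfl
    ext R
    simp only [smallPolymers, Finset.mem_filter, Finset.mem_powerset, Finset.subset_univ, true_and,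
      Finset.mem_singleton]
    constructor
    · rintro rfl
      simp [Finset.card_pair hkl]
    · rintro ⟨h | h, hk, hl⟩
      · obtain ⟨p, rfl⟩ := Finset.card_eq_one.1 h
        rw [Finset.mem_singleton] at hk hl
        exact absurd (hk.trans hl.symm) hkl
      · refine (Finset.eq_of_subset_of_card_le ?_ ?_).symm
        · intro x hx
          rcases Finset.mem_insert.1 hx with rfl | hx
          · exact hk
          · rwa [Finset.mem_singleton.1 hx]
        · rw [Finset.card_pair hkl, h]
  rw [h, meetSum, smallSum, smallSum, Finset.sum_filter, Finset.sum_filter, Finset.sum_filter,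
    ← Finset.sum_add_distrib, ← Finset.sum_sub_distrib]
  refine Finset.sum_congr rfl fun R _ => ?_
  by_cases h1 : k ∈ R <;> by_cases h2 : l ∈ R <;> simp [h1, h2]

/-- With `s k` the total small weight through `k`, the sum over intersecting pairs is `∑ (s k)²`
minus `∑ w {k, l} ²` over `k < l`: two equal two-point clusters share two points and are counted
twice. Expanding the squares gives the displayed terms. -/
theorem secondOrder_univ (w : Finset K → ℝ) :
    secondOrder w Finset.univ =
      -(1 / 2 * ∑ k, w {k} ^ 2
        + ∑ k, ∑ l with l ≠ k, w {k} * w {k, l}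
        + 1 / 2 * ∑ k, ∑ l with k < l, w {k, l} ^ 2
        + 1 / 2 * ∑ k, ∑ l with l ≠ k, ∑ p with p ≠ k ∧ p ≠ l, w {k, l} * w {k, p})
      + ∑ k, ∑ l with k < l, ∑ p with l < p, w {k, l, p} := by
  have h3 : ∑ R ∈ (Finset.univ : Finset K).powerset with R.card = 3, w R =
      ∑ k, ∑ l with k < l, ∑ p with l < p, w {k, l, p} := by
    rw [Finset.powerset_univ, sum_card_three]
  have hm : ∑ R₁ ∈ smallPolymers (Finset.univ : Finset K),
      ∑ R₂ ∈ smallPolymers (Finset.univ : Finset K),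
      (if Disjoint R₁ R₂ then 0 else -1) * w R₁ * w R₂ =
      -firstOrder (fun R => w R * meetSum w Finset.univ R) Finset.univ := by
    rw [firstOrder, ← Finset.sum_neg_distrib]
    refine Finset.sum_congr rfl fun R _ => ?_
    rw [meetSum, Finset.mul_sum, ← Finset.sum_neg_distrib]
    refine Finset.sum_congr rfl fun R' _ => ?_
    split_ifs <;> ring
  set s := smallSum w Finset.univ with hs
  have hpair : ∑ k, ∑ l with k < l, w {k, l} * meetSum w Finset.univ {k, l} =
      ∑ k, ∑ l with l ≠ k, w {k, l} * s k - ∑ k, ∑ l with k < l, w {k, l} ^ 2 := by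
    rw [sum_sum_ne_eq fun k l => w {k, l} * s k, ← Finset.sum_sub_distrib]
    refine Finset.sum_congr rfl fun k _ => ?_
    rw [← Finset.sum_sub_distrib]
    refine Finset.sum_congr rfl fun l hl => ?_
    rw [meetSum_univ_pair w (Finset.mem_filter.1 hl).2.ne, Finset.pair_comm l k]
    ring
  have hsq : ∑ k, ∑ l with l ≠ k, w {k, l} ^ 2 = 2 * ∑ k, ∑ l with k < l, w {k, l} ^ 2 := by
    rw [sum_sum_ne_eq fun k l => w {k, l} ^ 2, Finset.mul_sum]
    refine Finset.sum_congr rfl fun k _ => ?_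
    rw [Finset.mul_sum]
    refine Finset.sum_congr rfl fun l _ => ?_
    rw [Finset.pair_comm l k]
    ring
  have hs2 : ∀ k, w {k} * s k + ∑ l with l ≠ k, w {k, l} * s k =
      w {k} ^ 2 + 2 * ∑ l with l ≠ k, w {k} * w {k, l} + ∑ l with l ≠ k, w {k, l} ^ 2 +
        ∑ l with l ≠ k, ∑ p with p ≠ k ∧ p ≠ l, w {k, l} * w {k, p} := by
    intro k
    have hsk : s k = w {k} + ∑ l with l ≠ k, w {k, l} := smallSum_univ w k
    have hprod : (∑ l with l ≠ k, w {k, l}) * ∑ p with p ≠ k, w {k, p} =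
        ∑ l with l ≠ k, w {k, l} ^ 2 +
          ∑ l with l ≠ k, ∑ p with p ≠ k ∧ p ≠ l, w {k, l} * w {k, p} := by
      rw [Finset.sum_mul_sum, ← Finset.sum_add_distrib]
      refine Finset.sum_congr rfl fun l hl => ?_
      rw [← Finset.add_sum_erase _ _ hl, sq]
      congr 1
      refine Finset.sum_congr ?_ fun _ _ => rfl
      ext p
      simp only [Finset.mem_erase, Finset.mem_filter, Finset.mem_univ, true_and]
      tauto
    rw [← Finset.sum_mul, ← Finset.mul_sum]
    rw [hsk]
    linear_combination hprod
  have hall := Finset.sum_congr (s₁ := (Finset.univ : Finset K)) rfl fun k _ => hs2 k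
  simp only [Finset.sum_add_distrib, ← Finset.mul_sum Finset.univ] at hall
  rw [secondOrder, h3, hm, firstOrder_univ, hpair]
  simp only [meetSum_univ_singleton, ← hs]
  linear_combination -(1 / 2) * hall - 1 / 2 * hsq

end OrderedSums

theorem sum_filter_eq_sum_filter {ι : Type*} (s : Finset ι) (p q : ι → Prop) [DecidablePred p]
    [DecidablePred q] (g : ι → ℝ) (hpq : ∀ i, p i → q i) (h : ∀ i, q i → ¬ p i → g i = 0) :
    ∑ i ∈ s with p i, g i = ∑ i ∈ s with q i, g i := by
  refine Finset.sum_subset (fun i hi => ?_) fun i hi hi' => ?_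
  · rw [Finset.mem_filter] at *
    exact ⟨hi.1, hpq i hi.2⟩
  · rw [Finset.mem_filter] at *
    exact h i hi.2 fun hp => hi' ⟨hi.1, hp⟩

/-! ### The block-spin model as a polymer gas, and the explicit corrections. -/

namespace IsingModel

variable (S : IsingModel)

theorem circDist_comm (n a b : ℕ) : circDist n a b = circDist n b a := by
  rw [circDist, circDist, Nat.dist_comm]

theorem J_comm (x y : S.Site) : S.J x y = S.J y x := by
  rw [J, J, circDist_comm]

theorem Jbar_comm (k l : S.Cell) : S.Jbar k l = S.Jbar l k := by
  by_cases h : k = l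
  · rw [h]
  · rw [Jbar, Jbar, if_neg h, if_neg (Ne.symm h), Finset.sum_comm]
    simp only [S.J_comm]

/-- The sum over pairs of distinct sites in two cells. -/
noncomputable def pairSum (k l : S.Cell) (c : S.Site → S.Site → ℝ) : ℝ :=
  ∑ i : Fin S.q, ∑ j ∈ Finset.univ.filter (fun j : Fin S.q => (l, j) ≠ (k, i)), c (k, i) (l, j)

theorem pairSum_comm (k l : S.Cell) (c : S.Site → S.Site → ℝ) :
    S.pairSum k l c = S.pairSum l k fun x y => c y x := by
  simp only [pairSum]
  exact Finset.sum_comm' (by simp [eq_comm])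

theorem Delta_eq (k l : S.Cell) (σ : S.SpinConfig) :
    S.Delta k l σ = -(1 / 2) * (2 - if k = l then 1 else 0) *
      (S.pairSum k l (fun x y => S.J x y * S.spin σ x * S.spin σ y) -
        S.Jbar k l * S.pairSum k l fun x y => S.spin σ x * S.spin σ y) := by
  rw [Delta, mul_assoc]
  congr 1
  simp only [pairSum, Finset.mul_sum, ← Finset.sum_sub_distrib]
  exact Finset.sum_congr rfl fun i _ => Finset.sum_congr rfl fun j _ => by ring

theorem Delta_comm (k l : S.Cell) (σ : S.SpinConfig) : S.Delta k l σ = S.Delta l k σ := by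
  have h1 : (fun x y => S.J x y * S.spin σ x * S.spin σ y) =
      fun x y => S.J y x * S.spin σ y * S.spin σ x := by
    funext x y
    rw [J_comm, mul_right_comm]
  have h2 : (fun x y => S.spin σ x * S.spin σ y) = fun x y => S.spin σ y * S.spin σ x := by
    funext x y
    rw [mul_comm]
  rw [Delta_eq, Delta_eq, S.Jbar_comm k l, if_congr (eq_comm (a := k)) rfl rfl, S.pairSum_comm l k,
    S.pairSum_comm l k, ← h1, ← h2]

theorem f_comm (k l : S.Cell) (σ : S.SpinConfig) : S.f k l σ = S.f l k σ := by
  rw [f, f, Delta_comm]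

theorem spin_mul_self (σ : S.SpinConfig) (x : S.Site) : S.spin σ x * S.spin σ x = 1 := by
  rcases Int.units_eq_one_or (σ x) with h | h <;> simp [spin, h]

theorem sum_spin {η : S.CoarseConfig} {σ : S.SpinConfig} (hσ : S.block σ = η) (k : S.Cell) :
    ∑ i, S.spin σ (k, i) = ((η k : ℤ) : ℝ) := by
  rw [← hσ]
  simp [block, spin]

/-- For `k = l` the excluded diagonal is `q`, as spins square to one. Hence the averaged interaction
is a function of the block spins alone. -/
theorem pairSum_spin {η : S.CoarseConfig} {σ : S.SpinConfig} (hσ : S.block σ = η) (k l : S.Cell) :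
    S.pairSum k l (fun x y => S.spin σ x * S.spin σ y) =
      ((η k : ℤ) : ℝ) * ((η l : ℤ) : ℝ) - if k = l then (S.q : ℝ) else 0 := by
  rw [← S.sum_spin hσ k, ← S.sum_spin hσ l, Finset.sum_mul_sum, pairSum]
  by_cases hkl : k = l
  · subst hkl
    rw [if_pos rfl, eq_sub_iff_add_eq]
    have : (S.q : ℝ) = ∑ i : Fin S.q, S.spin σ (k, i) * S.spin σ (k, i) := by
      simp [spin_mul_self]
    rw [this, ← Finset.sum_add_distrib]
    refine Finset.sum_congr rfl fun i _ => ?_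
    have hf : (Finset.univ.filter fun j : Fin S.q => (k, j) ≠ (k, i)) = Finset.univ.erase i := by
      ext j
      simp
    rw [hf, Finset.sum_erase_add _ _ (Finset.mem_univ i)]
  · rw [if_neg hkl, sub_zero]
    refine Finset.sum_congr rfl fun i _ => Finset.sum_congr ?_ fun _ _ => rfl
    ext j
    simp [Ne.symm hkl]

theorem energy_eq (σ : S.SpinConfig) :
    S.energy σ = -(1 / 2) * ∑ k, ∑ l, S.pairSum k l (fun x y => S.J x y * S.spin σ x * S.spin σ y)
      + S.h * ∑ k, ∑ i, S.spin σ (k, i) := by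
  rw [energy, Fintype.sum_prod_type (f := S.spin σ), Fintype.sum_prod_type]
  congr 2
  refine Finset.sum_congr rfl fun k _ => ?_
  simp only [pairSum]
  rw [Finset.sum_comm]
  refine Finset.sum_congr rfl fun i _ => ?_
  rw [Finset.sum_filter, Fintype.sum_prod_type]
  exact Finset.sum_congr rfl fun l _ => (Finset.sum_filter _ _).symm

/-- The factor `2 - δ_{kl}` in `Delta` converts unordered pairs of cells into ordered ones. -/
theorem sum_Delta_eq (σ : S.SpinConfig) :
    ∑ e : Sym2 S.Cell, S.Delta e.inf e.sup σ =
      -(1 / 2) * ∑ k, ∑ l, (S.pairSum k l (fun x y => S.J x y * S.spin σ x * S.spin σ y) -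
        S.Jbar k l * S.pairSum k l fun x y => S.spin σ x * S.spin σ y) := by
  rw [sum_sym2_eq, sum_sum_eq, mul_add, Finset.mul_sum, Finset.mul_sum]
  congr 1
  · refine Finset.sum_congr rfl fun k _ => ?_
    rw [Sym2.inf_mk, Sym2.sup_mk, inf_idem, sup_idem, Delta_eq, if_pos rfl]
    ring
  · refine Finset.sum_congr rfl fun k _ => ?_
    rw [Finset.mul_sum]
    refine Finset.sum_congr rfl fun l hl => ?_
    have hl := (Finset.mem_filter.1 hl).2
    have h := S.Delta_comm k l σ
    rw [Sym2.inf_mk, Sym2.sup_mk, inf_of_le_left hl.le, sup_of_le_right hl.le]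
    rw [S.Delta_eq k l, S.Delta_eq l k, if_neg hl.ne, if_neg hl.ne'] at h
    rw [Delta_eq, if_neg hl.ne]
    linear_combination (1 / 2) * h

/-- The energy is the sum of its conditional expectation and of the fluctuations `Δ_{kl} J`. -/
theorem energy_eq_H0_add {η : S.CoarseConfig} {σ : S.SpinConfig} (hσ : S.block σ = η) :
    S.energy σ = S.H0 η + ∑ e : Sym2 S.Cell, S.Delta e.inf e.sup σ := by
  -- The remainder is constant on the fiber; taking conditional expectations identifies it with `H0
  -- η`, because every `Delta` has mean zero.
  obtain ⟨c, hc⟩ : ∃ c, ∀ σ, S.block σ = η →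
      S.energy σ = c + ∑ e : Sym2 S.Cell, S.Delta e.inf e.sup σ := by
    refine ⟨-(1 / 2) * ∑ k, ∑ l, S.Jbar k l * (((η k : ℤ) : ℝ) * ((η l : ℤ) : ℝ) -
      if k = l then (S.q : ℝ) else 0) + S.h * ∑ k, ((η k : ℤ) : ℝ), fun σ hσ => ?_⟩
    rw [energy_eq, sum_Delta_eq]
    simp only [S.pairSum_spin hσ, S.sum_spin hσ, Finset.sum_sub_distrib]
    ring
  have h : S.H0 η = c := by
    rw [H0, S.condExpect_congr hc, condExpect_add, condExpect_const, condExpect_sum]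
    simp [condExpect_Delta]
  rw [h, hc σ hσ]

/-- The weight of an edge between two cells. -/
noncomputable def edgeWeight (σ : S.SpinConfig) (e : Sym2 S.Cell) : ℝ := S.f e.inf e.sup σ

theorem edgeWeight_mk (σ : S.SpinConfig) (k l : S.Cell) : S.edgeWeight σ s(k, l) = S.f k l σ := by
  rw [edgeWeight, Sym2.inf_mk, Sym2.sup_mk]
  rcases le_total k l with h | h
  · rw [inf_of_le_left h, sup_of_le_right h]
  · rw [inf_of_le_right h, sup_of_le_left h, f_comm]

theorem f_congr {k l : S.Cell} {σ τ : S.SpinConfig}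
    (h : ∀ x : S.Site, x.1 = k ∨ x.1 = l → σ x = τ x) : S.f k l σ = S.f k l τ := by
  have h1 : ∀ x : S.Site, x.1 = k ∨ x.1 = l → S.spin σ x = S.spin τ x := fun x hx => by
    rw [spin, spin, h x hx]
  simp only [f, Delta]
  rw [Finset.sum_congr rfl fun i _ => Finset.sum_congr rfl fun j _ => by
    rw [h1 (k, i) (Or.inl rfl), h1 (l, j) (Or.inr rfl)]]

theorem edgeWeight_congr {A : Finset S.Cell} {σ τ : S.SpinConfig}
    (h : ∀ x : S.Site, x.1 ∈ A → σ x = τ x) {e : Sym2 S.Cell} (he : e ∈ A.sym2) :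
    S.edgeWeight σ e = S.edgeWeight τ e := by
  induction e using Sym2.ind with
  | h k l =>
    rw [Finset.mk_mem_sym2_iff] at he
    rw [edgeWeight_mk, edgeWeight_mk]
    refine S.f_congr fun x hx => h x ?_
    rcases hx with hx | hx
    · exact hx ▸ he.1
    · exact hx ▸ he.2

open scoped Classical in
theorem localOn_connectedSum (R : Finset S.Cell) :
    S.LocalOn R fun σ => connectedSum (S.edgeWeight σ) R := by
  intro σ τ h
  unfold connectedSum
  refine Finset.sum_congr rfl fun g hg => Finset.prod_congr rfl fun e he => ?_
  exact S.edgeWeight_congr h ((Finset.mem_filter.1 hg).2.subset_sym2 he)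

theorem localOn_prod (A : Finset S.Cell) :
    S.LocalOn A fun σ => ∏ e ∈ A.sym2, (1 + S.edgeWeight σ e) :=
  fun σ τ h => Finset.prod_congr rfl fun e he => by rw [S.edgeWeight_congr h he]

theorem activity_eq (η : S.CoarseConfig) (R : Finset S.Cell) :
    S.activity η R = S.condExpect η fun σ => connectedSum (S.edgeWeight σ) R := rfl

/-- The partition function of the clusters of cells in `Λ`. -/
noncomputable def clusterZ (η : S.CoarseConfig) (Λ : Finset S.Cell) : ℝ :=
  S.condExpect η fun σ => ∏ e ∈ Λ.sym2, (1 + S.edgeWeight σ e)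

theorem isPolymerGas (η : S.CoarseConfig) : IsPolymerGas (S.activity η) (S.clusterZ η) where
  empty := by simp [clusterZ, condExpect_const]
  step Λ k hk := by
    rw [clusterZ]
    simp only [fun σ => prod_one_add_sym2 (S.edgeWeight σ) hk]
    rw [condExpect_add, condExpect_sum]
    congr 1
    refine Finset.sum_congr rfl fun R hR => ?_
    -- The connected graph on `R` and the product on `Λ \ R` involve disjoint cells, so their
    -- expectation factorises.
    rw [S.condExpect_mul (S.localOn_connectedSum R) (S.localOn_prod (Λ \ R))
      Finset.disjoint_sdiff, activity_eq, clusterZ]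

theorem smallWeights {η : S.CoarseConfig} {δ : ℝ} (h : S.SmallActivity δ η) :
    SmallWeights (S.activity η) δ := ⟨h.1, h.2⟩

theorem prod_one_add_edgeWeight (σ : S.SpinConfig) :
    ∏ e ∈ (Finset.univ : Finset S.Cell).sym2, (1 + S.edgeWeight σ e) =
      Real.exp (-S.β * ∑ e : Sym2 S.Cell, S.Delta e.inf e.sup σ) := by
  rw [Finset.sym2_univ, Finset.mul_sum, Real.exp_sum]
  exact Finset.prod_congr rfl fun e _ => by rw [edgeWeight, f]; ring

/-- Jensen's inequality in the form `1 + x ≤ exp x`, applied to an exponent of conditional mean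
zero. -/
theorem one_le_clusterZ (η : S.CoarseConfig) : 1 ≤ S.clusterZ η Finset.univ := by
  have h : S.condExpect η (fun σ => 1 + -S.β * ∑ e : Sym2 S.Cell, S.Delta e.inf e.sup σ) = 1 := by
    rw [condExpect_add, condExpect_const, condExpect_const_mul, condExpect_sum]
    simp [condExpect_Delta]
  refine h.ge.trans (S.condExpect_mono fun σ => ?_)
  rw [prod_one_add_edgeWeight, add_comm]
  exact Real.add_one_le_exp _

theorem log_clusterZ (η : S.CoarseConfig) :
    Real.log (S.clusterZ η Finset.univ) = -S.β * (S.exactH η - S.H0 η) := by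
  have h : S.condExpect η (fun σ => Real.exp (-S.β * S.energy σ)) =
      Real.exp (-S.β * S.H0 η) * S.clusterZ η Finset.univ := by
    rw [clusterZ, ← condExpect_const_mul]
    refine S.condExpect_congr fun σ hσ => ?_
    rw [prod_one_add_edgeWeight, ← Real.exp_add, S.energy_eq_H0_add hσ]
    ring_nf
  have hβ := S.β_pos.ne'
  rw [exactH, h, Real.log_mul (Real.exp_ne_zero _) (by linarith [S.one_le_clusterZ η]),
    Real.log_exp]
  field_simp
  ring

theorem near_comm (k l : S.Cell) : S.Near k l ↔ S.Near l k := by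
  rw [Near, Near, circDist_comm]

/-- If two cells are more than `c = ⌈L/q⌉` apart, their sites are more than `c * q ≥ L` apart,
beyond the range of `V`. This makes the restrictions to near cells in `H1` and `H2` harmless. -/
theorem J_eq_zero {k l : S.Cell} (h : ¬ S.Near k l) (i j : Fin S.q) : S.J (k, i) (l, j) = 0 := by
  wlog hkl : k ≤ l generalizing k l i j
  · rw [J_comm]
    exact this (fun h' => h ((S.near_comm k l).2 h')) j i (le_of_not_ge hkl)
  have hq := S.q_pos
  have hL : (0 : ℝ) < S.L := Nat.cast_pos.2 S.L_pos
  rw [Near, not_le] at h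
  set c := ⌈(S.L : ℚ) / S.q⌉₊ with hc
  have hcL : S.L ≤ c * S.q := by
    have h1 : (S.L : ℚ) / S.q ≤ c := Nat.le_ceil _
    rw [div_le_iff₀ (by exact_mod_cast hq)] at h1
    exact_mod_cast h1
  have key : S.L ≤ circDist (S.m * S.q) (S.pos (k, i)) (S.pos (l, j)) := by
    have hl := l.2
    obtain ⟨d, hd⟩ := Nat.exists_eq_add_of_le (show (k : ℕ) ≤ l from hkl)
    simp only [circDist, Nat.dist, pos, lt_min_iff, le_min_iff] at h ⊢
    rw [hd] at h hl ⊢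
    -- The two arcs of the circle have lengths `d` and `e` in cells. Both are at least `c + 1`, and
    -- the positions inside the cells cost less than `q` sites.
    obtain ⟨e, he⟩ := Nat.exists_eq_add_of_le (show d ≤ S.m by omega)
    have h1 : c + 1 ≤ d := by omega
    have h2 : c + 1 ≤ e := by omega
    have h3 := Nat.mul_le_mul_right S.q h1
    have h4 := Nat.mul_le_mul_right S.q h2
    have h5 : S.m * S.q = d * S.q + e * S.q := by rw [he, add_mul]
    rw [h5]
    rw [add_mul] at h3 h4 ⊢
    have hi := i.2
    have hj := j.2
    constructor <;> omega
  rw [J, S.V_eq_zero _ ((one_le_div hL).2 (by exact_mod_cast key)), mul_zero]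

theorem near_self (k : S.Cell) : S.Near k k := by
  simp [Near, circDist]

theorem f_eq_zero {k l : S.Cell} (h : ¬ S.Near k l) (σ : S.SpinConfig) : S.f k l σ = 0 := by
  have hkl : k ≠ l := fun hkl => h (hkl ▸ S.near_self k)
  simp [f, Delta, Jbar, S.J_eq_zero h, hkl]

theorem z2_eq_zero {k l : S.Cell} (h : ¬ S.Near k l) (η : S.CoarseConfig) : S.z2 η k l = 0 := by
  simp [z2, S.f_eq_zero h, condExpect_const]

/-- Each of the four products needs at least two edges of the triangle to be non-zero, hence two
near pairs. -/
theorem z3_eq_zero {k l p : S.Cell} (h : ¬ ((S.Near k l ∧ S.Near l p) ∨ (S.Near k l ∧ S.Near k p) ∨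
    (S.Near k p ∧ S.Near l p))) (η : S.CoarseConfig) : S.z3 η k l p = 0 := by
  have h0 : ∀ σ, S.f k l σ * S.f l p σ + S.f k l σ * S.f k p σ + S.f k p σ * S.f l p σ
        + S.f k l σ * S.f l p σ * S.f k p σ = 0 := by
    intro σ
    by_cases h1 : S.Near k l <;> by_cases h2 : S.Near l p <;> by_cases h3 : S.Near k p <;>
      first | tauto | simp [S.f_eq_zero, *]
  simp only [z3, h0, zero_mul, condExpect_const]

theorem activity_singleton (η : S.CoarseConfig) (k : S.Cell) : S.activity η {k} = S.z1 η k := by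
  simp only [activity_eq, connectedSum_singleton, edgeWeight_mk]
  rfl

theorem activity_pair (η : S.CoarseConfig) {k l : S.Cell} (hkl : k ≠ l) :
    S.activity η {k, l} = S.z2 η k l := by
  simp only [activity_eq, connectedSum_pair _ hkl, edgeWeight_mk, z2]
  congr 1
  funext σ
  ring

theorem activity_triple (η : S.CoarseConfig) {k l p : S.Cell} (hkl : k ≠ l) (hkp : k ≠ p)
    (hlp : l ≠ p) : S.activity η {k, l, p} = S.z3 η k l p := by
  simp only [activity_eq, connectedSum_triple _ hkl hkp hlp, edgeWeight_mk, z3]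

open scoped Classical in
theorem H1_eq (η : S.CoarseConfig) :
    S.H1 η = -(1 / S.β) * firstOrder (S.activity η) Finset.univ := by
  rw [H1, firstOrder_univ]
  congr 2
  · exact Finset.sum_congr rfl fun k _ => (S.activity_singleton η k).symm
  · refine Finset.sum_congr rfl fun k _ => ?_
    rw [sum_filter_eq_sum_filter _ _ (fun l => k < l) _ (fun _ h => h.1)
      fun l h h' => S.z2_eq_zero (fun hn => h' ⟨h, hn⟩) η]
    exact Finset.sum_congr rfl fun l hl => (S.activity_pair η (Finset.mem_filter.1 hl).2.ne).symm

open scoped Classical in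
theorem H2_eq (η : S.CoarseConfig) :
    S.H2 η = -(1 / S.β) * secondOrder (S.activity η) Finset.univ := by
  have e1 : ∑ k, ∑ l : S.Cell with l ≠ k, S.activity η {k} * S.activity η {k, l} =
      ∑ k, ∑ l : S.Cell with l ≠ k, S.z1 η k * S.z2 η k l :=
    Finset.sum_congr rfl fun k _ => Finset.sum_congr rfl fun l hl => by
      rw [activity_singleton, S.activity_pair η (Finset.mem_filter.1 hl).2.symm]
  have e2 : ∑ k, ∑ l : S.Cell with k < l, S.activity η {k, l} ^ 2 =
      ∑ k, ∑ l : S.Cell with k < l, S.z2 η k l ^ 2 :=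
    Finset.sum_congr rfl fun k _ => Finset.sum_congr rfl fun l hl => by
      rw [S.activity_pair η (Finset.mem_filter.1 hl).2.ne]
  have e3 : ∑ k, ∑ l : S.Cell with l ≠ k, ∑ p : S.Cell with p ≠ k ∧ p ≠ l,
        S.activity η {k, l} * S.activity η {k, p} =
      ∑ k, ∑ l : S.Cell with l ≠ k, ∑ p : S.Cell with p ≠ k ∧ p ≠ l, S.z2 η k l * S.z2 η k p :=
    Finset.sum_congr rfl fun k _ => Finset.sum_congr rfl fun l hl =>
      Finset.sum_congr rfl fun p hp => by
        rw [S.activity_pair η (Finset.mem_filter.1 hl).2.symm,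
          S.activity_pair η (Finset.mem_filter.1 hp).2.1.symm]
  have e4 : ∑ k, ∑ l : S.Cell with k < l, ∑ p : S.Cell with l < p, S.activity η {k, l, p} =
      ∑ k, ∑ l : S.Cell with k < l, ∑ p : S.Cell with l < p, S.z3 η k l p :=
    Finset.sum_congr rfl fun k _ => Finset.sum_congr rfl fun l hl =>
      Finset.sum_congr rfl fun p hp => by
        have hl := (Finset.mem_filter.1 hl).2
        have hp := (Finset.mem_filter.1 hp).2
        rw [S.activity_triple η hl.ne (hl.trans hp).ne hp.ne]
  rw [secondOrder_univ, e1, e2, e3, e4]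
  simp only [activity_singleton]
  rw [H2]
  have n1 : ∀ k, ∑ l : S.Cell with l ≠ k ∧ S.Near k l, S.z1 η k * S.z2 η k l =
      ∑ l : S.Cell with l ≠ k, S.z1 η k * S.z2 η k l := fun k =>
    sum_filter_eq_sum_filter _ _ _ _ (fun _ h => h.1) fun l h h' => by
      rw [S.z2_eq_zero (fun hn => h' ⟨h, hn⟩), mul_zero]
  have n2 : ∀ k, ∑ l : S.Cell with k < l ∧ S.Near k l, S.z2 η k l ^ 2 =
      ∑ l : S.Cell with k < l, S.z2 η k l ^ 2 := fun k =>
    sum_filter_eq_sum_filter _ _ _ _ (fun _ h => h.1) fun l h h' => by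
      rw [S.z2_eq_zero (fun hn => h' ⟨h, hn⟩), sq, mul_zero]
  have n3 : ∀ k l, ∑ p : S.Cell with p ≠ k ∧ p ≠ l ∧ S.Near k p, S.z2 η k l * S.z2 η k p =
      ∑ p : S.Cell with p ≠ k ∧ p ≠ l, S.z2 η k l * S.z2 η k p := fun k l =>
    sum_filter_eq_sum_filter _ _ _ _ (fun _ h => ⟨h.1, h.2.1⟩) fun p h h' => by
      rw [S.z2_eq_zero (fun hn => h' ⟨h.1, h.2, hn⟩), mul_zero]
  have n4 : ∀ k, ∑ l : S.Cell with l ≠ k ∧ S.Near k l,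
      ∑ p : S.Cell with p ≠ k ∧ p ≠ l, S.z2 η k l * S.z2 η k p =
      ∑ l : S.Cell with l ≠ k, ∑ p : S.Cell with p ≠ k ∧ p ≠ l, S.z2 η k l * S.z2 η k p := fun k =>
    sum_filter_eq_sum_filter _ _ _ _ (fun _ h => h.1) fun l h h' => by
      simp [S.z2_eq_zero (fun hn => h' ⟨h, hn⟩)]
  have n5 : ∀ k l, ∑ p : S.Cell with l < p ∧
      ((S.Near k l ∧ S.Near l p) ∨ (S.Near k l ∧ S.Near k p) ∨ (S.Near k p ∧ S.Near l p)),
        S.z3 η k l p = ∑ p : S.Cell with l < p, S.z3 η k l p := fun k l =>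
    sum_filter_eq_sum_filter _ _ _ _ (fun _ h => h.1) fun p h h' =>
      S.z3_eq_zero (fun hn => h' ⟨h, hn⟩) η
  simp only [n1, n2, n3, n4, n5]
  ring

end IsingModel

/-! ### Relative entropy of the coarse Gibbs measures. -/

/-- The log-density is `φ` minus the logarithm of the normalisation. Since `φ ≤ ε` and that
logarithm is at least `-ε`, it is pointwise at most `2ε`. -/
theorem klDiv_tilted_le {Ω : Type*} [Finite Ω] [MeasurableSpace Ω] [MeasurableSingletonClass Ω]
    (ν : Measure Ω) [IsProbabilityMeasure ν] {φ : Ω → ℝ} {ε : ℝ} (h : ∀ x, |φ x| ≤ ε) :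
    klDiv (ν.tilted φ) ν ≤ ENNReal.ofReal (2 * ε) := by
  have hint : Integrable (fun x => Real.exp (φ x)) ν := Integrable.of_finite
  have := isProbabilityMeasure_tilted hint
  have hac : ν.tilted φ ≪ ν := tilted_absolutelyContinuous ν φ
  have hllr : llr (ν.tilted φ) ν =ᵐ[ν.tilted φ]
      fun x => φ x - Real.log (∫ z, Real.exp (φ z) ∂ν) := by
    have h1 := llr_tilted_left (Measure.AbsolutelyContinuous.refl ν) hint
      (measurable_of_finite φ).aemeasurable
    refine hac.ae_le ?_
    filter_upwards [h1, llr_self ν] with x hx hx'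
    rw [hx, hx', Pi.zero_apply, add_zero]
  have hlower : Real.exp (-ε) ≤ ∫ z, Real.exp (φ z) ∂ν := by
    have := integral_mono (μ := ν) (integrable_const (Real.exp (-ε))) hint
      fun x => Real.exp_le_exp.2 (abs_le.1 (h x)).1
    simpa using this
  have hlog : -ε ≤ Real.log (∫ z, Real.exp (φ z) ∂ν) :=
    (Real.le_log_iff_exp_le ((Real.exp_pos _).trans_le hlower)).2 hlower
  rw [klDiv_of_ac_of_integrable hac Integrable.of_finite]
  refine ENNReal.ofReal_le_ofReal ?_
  rw [probReal_univ, probReal_univ, add_sub_cancel_right, integral_congr_ae hllr]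
  have := integral_mono (μ := ν.tilted φ)
    (f := fun x => φ x - Real.log (∫ z, Real.exp (φ z) ∂ν)) (g := fun _ => 2 * ε)
    Integrable.of_finite (integrable_const _) fun x => by
      have := (abs_le.1 (h x)).2
      simp only
      linarith
  simpa using this

namespace IsingModel

variable (S : IsingModel)

theorem setIntegral_prior (η : S.CoarseConfig) (g : S.SpinConfig → ℝ) :
    ∫ σ in S.block ⁻¹' {η}, g σ ∂S.prior =
      S.prior.real (S.block ⁻¹' {η}) * S.condExpect η g := by
  have h : S.prior.real (S.block ⁻¹' {η}) ≠ 0 :=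
    ENNReal.toReal_ne_zero.2 ⟨S.prior_preimage_ne_zero η, measure_ne_top _ _⟩
  rw [condExpect, condPrior, ProbabilityTheory.cond, integral_smul_measure, ENNReal.toReal_inv,
    smul_eq_mul, ← measureReal_def, mul_inv_cancel_left₀ h]

theorem exp_exactH (η : S.CoarseConfig) :
    Real.exp (-S.β * S.exactH η) = S.condExpect η fun σ => Real.exp (-S.β * S.energy σ) := by
  have hpos : 0 < S.condExpect η fun σ => Real.exp (-S.β * S.energy σ) := by
    rw [condExpect_eq]
    exact mul_pos (inv_pos.2 (Nat.cast_pos.2 (Finset.card_pos.2 (S.fiber_nonempty η))))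
      (Finset.sum_pos (fun _ _ => Real.exp_pos _) (S.fiber_nonempty η))
  have hβ := S.β_pos.ne'
  rw [exactH, show -S.β * (-(1 / S.β) * Real.log _) = Real.log
    (S.condExpect η fun σ => Real.exp (-S.β * S.energy σ)) by field_simp, Real.exp_log hpos]

instance : IsProbabilityMeasure S.coarsePrior :=
  Measure.isProbabilityMeasure_map (measurable_of_finite _).aemeasurable

instance : IsProbabilityMeasure S.microGibbs := isProbabilityMeasure_tilted Integrable.of_finite

/-- The coarse-grained microscopic Gibbs measure is the Gibbs measure of the exact coarse-grained
Hamiltonian. -/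
theorem map_microGibbs :
    S.microGibbs.map S.block = S.coarsePrior.tilted fun η => -S.β * S.exactH η := by
  have hm : Measurable S.block := measurable_of_finite _
  have : IsProbabilityMeasure (S.microGibbs.map S.block) :=
    Measure.isProbabilityMeasure_map hm.aemeasurable
  have : IsProbabilityMeasure (S.coarsePrior.tilted fun η => -S.β * S.exactH η) :=
    isProbabilityMeasure_tilted Integrable.of_finite
  -- Both measures have point masses proportional to `W`; total mass one then forces equal
  -- constants, so the partition functions need not be compared.
  set W : S.CoarseConfig → ℝ := fun η => S.prior.real (S.block ⁻¹' {η}) *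
    S.condExpect η fun σ => Real.exp (-S.β * S.energy σ) with hW
  obtain ⟨a, ha⟩ : ∃ a : ℝ, ∀ η, (S.microGibbs.map S.block).real {η} = a * W η := by
    refine ⟨(∫ σ, Real.exp (-S.β * S.energy σ) ∂S.prior)⁻¹, fun η => ?_⟩
    rw [measureReal_def, Measure.map_apply hm (measurableSet_singleton η), microGibbs,
      tilted_apply_eq_ofReal_integral, ENNReal.toReal_ofReal
        (integral_nonneg fun _ => div_nonneg (Real.exp_pos _).le
          (integral_nonneg fun _ => (Real.exp_pos _).le)), integral_div, setIntegral_prior,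
      div_eq_inv_mul]
  obtain ⟨b, hb⟩ : ∃ b : ℝ, ∀ η,
      (S.coarsePrior.tilted fun η => -S.β * S.exactH η).real {η} = b * W η := by
    refine ⟨(∫ η, Real.exp (-S.β * S.exactH η) ∂S.coarsePrior)⁻¹, fun η => ?_⟩
    rw [measureReal_def, tilted_apply_eq_ofReal_integral, ENNReal.toReal_ofReal
        (integral_nonneg fun _ => div_nonneg (Real.exp_pos _).le
          (integral_nonneg fun _ => (Real.exp_pos _).le)), integral_div, integral_singleton,
      exp_exactH, smul_eq_mul, coarsePrior, measureReal_def,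
      Measure.map_apply hm (measurableSet_singleton η), ← measureReal_def, div_eq_inv_mul]
  have ha1 : a * ∑ η, W η = 1 := by
    rw [Finset.mul_sum, ← Finset.sum_congr rfl fun η _ => ha η, sum_measureReal_singleton,
      Finset.coe_univ, probReal_univ]
  have hb1 : b * ∑ η, W η = 1 := by
    rw [Finset.mul_sum, ← Finset.sum_congr rfl fun η _ => hb η, sum_measureReal_singleton,
      Finset.coe_univ, probReal_univ]
  refine Measure.ext_of_measureReal_singleton fun η => ?_
  rw [ha, hb, eq_inv_of_mul_eq_one_left ha1, eq_inv_of_mul_eq_one_left hb1]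

theorem klDiv_effectiveGibbs_le (p : Fin 3) {ε : ℝ}
    (h : ∀ η, S.β * |S.exactH η - S.effectiveH p η| ≤ ε) :
    klDiv (S.effectiveGibbs p) (S.microGibbs.map S.block) ≤ ENNReal.ofReal (2 * ε) := by
  have : IsProbabilityMeasure (S.coarsePrior.tilted fun η => -S.β * S.exactH η) :=
    isProbabilityMeasure_tilted Integrable.of_finite
  -- Tilts compose additively, so the coarse prior cancels and only the error of the Hamiltonian
  -- remains.
  have e : S.effectiveGibbs p = (S.coarsePrior.tilted fun η => -S.β * S.exactH η).tilted
      fun η => S.β * (S.exactH η - S.effectiveH p η) := by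
    rw [tilted_tilted Integrable.of_finite, effectiveGibbs]
    congr 1
    funext η
    simp only [Pi.add_apply]
    ring
  rw [map_microGibbs, e]
  refine klDiv_tilted_le _ fun η => ?_
  rw [abs_mul, abs_of_pos S.β_pos]
  exact h η

theorem corrections_le {δ : ℝ} (hδ : δ < 1 / 6) {η : S.CoarseConfig} (h : S.SmallActivity δ η) :
    S.β * |S.exactH η - S.H0 η| ≤ 12000 * S.m * δ ∧
    S.β * |S.exactH η - (S.H0 η + S.H1 η)| ≤ 12000 * S.m * δ ^ 2 ∧
    S.β * |S.exactH η - (S.H0 η + S.H1 η + S.H2 η)| ≤ 12000 * S.m * δ ^ 3 := by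
  have hw := S.smallWeights h
  -- `δ ≥ 0` follows from the one-cell condition, because there is at least one cell.
  have h0 := (S.isPolymerGas η).abs_log_le hw (hw.nonneg ⟨0, S.m_pos⟩) hδ.le (S.one_le_clusterZ η)
  have hβ := S.β_pos.ne'
  rw [log_clusterZ, Finset.card_univ, Fintype.card_fin] at h0
  have e : ∀ x y : ℝ, -S.β * x = y → S.β * |x| = |y| := by
    rintro x y rfl
    rw [abs_mul, abs_neg, abs_of_pos S.β_pos]
  refine ⟨?_, ?_, ?_⟩
  · rw [e _ _ rfl]
    exact h0.1
  · rw [e _ (-S.β * (S.exactH η - S.H0 η) - firstOrder (S.activity η) Finset.univ)]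
    · exact h0.2.1
    · rw [H1_eq]
      field_simp
      ring
  · rw [e _ (-S.β * (S.exactH η - S.H0 η) - (firstOrder (S.activity η) Finset.univ +
      secondOrder (S.activity η) Finset.univ))]
    · exact h0.2.2
    · rw [H1_eq, H2_eq]
      field_simp
      ring

end IsingModel

end CoarseGraining

theorem mainTheorem3 :
    (∀ (S : CoarseGraining.IsingModel) (η : S.CoarseConfig),
      S.H1 η = -(1 / S.β) *
          ∑ R : Finset S.Cell with R.card = 1 ∨ R.card = 2, S.activity η R ∧
      S.H2 η = -(1 / S.β) *
          (1 / 2 * ∑ R₁ : Finset S.Cell with R₁.card = 1 ∨ R₁.card = 2,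
              ∑ R₂ : Finset S.Cell with R₂.card = 1 ∨ R₂.card = 2,
                S.phi R₁ R₂ * S.activity η R₁ * S.activity η R₂
            + ∑ R : Finset S.Cell with R.card = 3, S.activity η R)) ∧
    ∃ C : ℝ, ∀ (S : CoarseGraining.IsingModel) (δ : ℝ), δ < 1 / 6 →
      (∀ η : S.CoarseConfig, S.SmallActivity δ η) →
      (∀ η : S.CoarseConfig,
        S.β * |S.exactH η - S.H0 η| ≤ C * S.m * δ ∧
        S.β * |S.exactH η - (S.H0 η + S.H1 η)| ≤ C * S.m * δ ^ 2 ∧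
        S.β * |S.exactH η - (S.H0 η + S.H1 η + S.H2 η)| ≤ C * S.m * δ ^ 3) ∧
      ∀ p : Fin 3,
        ((S.m * S.q : ℕ) : ENNReal)⁻¹ *
            InformationTheory.klDiv (S.effectiveGibbs p) (S.microGibbs.map S.block) ≤
          ENNReal.ofReal (C * δ ^ ((p : ℕ) + 1) / S.q) := by
  -- Twice the constant `12000` of the Hamiltonian bounds, for the factor two in the entropy
  -- estimate. Dividing by `N = m * q` cancels `m` and leaves `1 / q`.
  refine ⟨fun S η => ⟨?_, ?_⟩, 24000, fun S δ hδ h => ⟨fun η => ?_, fun p => ?_⟩⟩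
  · rw [S.H1_eq, CoarseGraining.firstOrder, CoarseGraining.smallPolymers, Finset.powerset_univ]
  · rw [S.H2_eq, CoarseGraining.secondOrder, CoarseGraining.smallPolymers, Finset.powerset_univ]
    rfl
  · have hδ0 : 0 ≤ δ := (S.smallWeights (h η)).nonneg ⟨0, S.m_pos⟩
    obtain ⟨h1, h2, h3⟩ := S.corrections_le hδ (h η)
    have hm : (0 : ℝ) ≤ S.m := Nat.cast_nonneg _
    refine ⟨h1.trans ?_, h2.trans ?_, h3.trans ?_⟩ <;> gcongr <;> norm_num
  · have hm : (0 : ℝ) < S.m := Nat.cast_pos.2 S.m_pos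
    have hq : (0 : ℝ) < S.q := Nat.cast_pos.2 S.q_pos
    have hε : ∀ η, S.β * |S.exactH η - S.effectiveH p η| ≤ 12000 * S.m * δ ^ ((p : ℕ) + 1) := by
      intro η
      obtain ⟨h1, h2, h3⟩ := S.corrections_le hδ (h η)
      fin_cases p
      · simpa [CoarseGraining.IsingModel.effectiveH] using h1
      · simpa [CoarseGraining.IsingModel.effectiveH] using h2
      · simpa [CoarseGraining.IsingModel.effectiveH] using h3
    have hN : (0 : ℝ) < (S.m * S.q : ℕ) := by
      push_cast
      positivity
    calc _ ≤ ((S.m * S.q : ℕ) : ENNReal)⁻¹ *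
          ENNReal.ofReal (2 * (12000 * S.m * δ ^ ((p : ℕ) + 1))) := by
          gcongr
          exact S.klDiv_effectiveGibbs_le p hε
      _ = _ := by
          rw [← ENNReal.ofReal_natCast, ← ENNReal.ofReal_inv_of_pos hN,
            ← ENNReal.ofReal_mul (inv_nonneg.2 hN.le)]
          congr 1
          push_cast
          field_simp
          ring
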